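/- Let $M$ be a connected smooth ($C^\infty$, Hausdorff, second countable, without boundary) manifold of dimension $n\ge 1$, and let $\Theta$ be a smooth tensor field of type $(1,1)$ on $M$, viewed as a field of endomorphisms $\Theta_x:T_xM\to T_xM$. Suppose that $\Theta$ is nilpotent (every $\Theta_x$ is nilpotent) and algebraically constant: for any $x,y\in M$ there is a linear isomorphism $T_xM\to T_yM$ sending $\Theta_x$ to $\Theta_y$. Let $N$ be the Nijenhuis tensor of $\Theta$, given by $$N(v,w)=\Theta[\Theta v,w]+\Theta[v,\Theta w]-[\Theta v,\Theta w]-\Theta^2[v,w]$$ for smooth vector fields $v,w$ on $M$. Then the following four conditions are equivalent. (i) $N=0$ identically, and the distribution $\mathrm{Ker}\,\Theta^i\subseteq TM$ is integrable for every $i=1,\dots,n$ (that is, around each point of $M$ there are local coordinates in which this distribution becomes a constant vector subspace of $\mathbb R^n$). (ii) Each point of $M$ has a neighborhood $U$ with a smooth frame $e_1,\dots,e_n$ of $TU$ such that $[e_i,e_j]=0$ on $U$ for all $i,j$ and $\Theta$ has Jordan normal form in this frame: $\Theta e_1=0$ on $U$ and, for each $i>1$, either $\Theta e_i=0$ on $U$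 or $\Theta e_i=e_{i-1}$ on $U$. (iii) $\Theta$ is locally constant: around each point of $M$ there are local coordinates in which the components of $\Theta$ are constant. (iv) $\Theta$ is integrable: there is a smooth torsion-free connection $\nabla$ on $TM$ with $\nabla\Theta=0$. -/

import Mathlib

open scoped Manifold ContDiff Bundle

noncomputable section

namespace NilpotentTensor

variable {n : ℕ} {M : Type*} [TopologicalSpace M] [ChartedSpace (EuclideanSpace ℝ (Fin n)) M]

/-- A (1,1) tensor field, as a field of endomorphisms of the tangent spaces
(smoothness is the separate predicate `IsSmooth`). -/
abbrev EndoField (n : ℕ) (M : Type*) [TopologicalSpace M]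
    [ChartedSpace (EuclideanSpace ℝ (Fin n)) M] : Type _ :=
  (x : M) → (TangentSpace (𝓡 n) x →L[ℝ] TangentSpace (𝓡 n) x)

/-- A vector field, not necessarily smooth. -/
abbrev VecField (n : ℕ) (M : Type*) [TopologicalSpace M]
    [ChartedSpace (EuclideanSpace ℝ (Fin n)) M] : Type _ :=
  (x : M) → TangentSpace (𝓡 n) x

/-- Smoothness of a vector field, as a section of the tangent bundle. -/
def VecField.IsSmooth [IsManifold (𝓡 n) ∞ M] (v : VecField n M) : Prop :=
  ContMDiff (𝓡 n) ((𝓡 n).prod 𝓘(ℝ, EuclideanSpace ℝ (Fin n))) ∞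
    (fun x => (⟨x, v x⟩ :
      Bundle.TotalSpace (EuclideanSpace ℝ (Fin n)) (TangentSpace (𝓡 n) : M → Type _)))

/-- Smoothness of a (1,1) tensor field, as a section of the bundle `Hom(TM, TM)`. -/
def EndoField.IsSmooth [IsManifold (𝓡 n) ∞ M] (Θ : EndoField n M) : Prop :=
  ContMDiff (𝓡 n)
    ((𝓡 n).prod 𝓘(ℝ, EuclideanSpace ℝ (Fin n) →L[ℝ] EuclideanSpace ℝ (Fin n))) ∞
    (fun x => (⟨x, Θ x⟩ :
      Bundle.TotalSpace (EuclideanSpace ℝ (Fin n) →L[ℝ] EuclideanSpace ℝ (Fin n))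
        (fun x : M => TangentSpace (𝓡 n) x →L[ℝ] TangentSpace (𝓡 n) x)))

/-- The vector field `Θ v`. -/
def EndoField.app (Θ : EndoField n M) (v : VecField n M) : VecField n M :=
  fun x => Θ x (v x)

/-- `Θ` is algebraically constant: for any two points some linear isomorphism between the
tangent spaces sends `Θ_x` to `Θ_y`. -/
def EndoField.AlgebraicallyConstant (Θ : EndoField n M) : Prop :=
  ∀ x y : M, ∃ L : TangentSpace (𝓡 n) x ≃ₗ[ℝ] TangentSpace (𝓡 n) y,
    ∀ v, L (Θ x v) = Θ y (L v)

/-- `Θ` is nilpotent (at every point). -/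
def EndoField.Nilpotent (Θ : EndoField n M) : Prop :=
  ∀ x : M, IsNilpotent (Θ x)

/-- The Nijenhuis tensor
`N(v, w) = Θ[Θv, w] + Θ[v, Θw] - [Θv, Θw] - Θ²[v, w]`. -/
def EndoField.nijenhuis (Θ : EndoField n M) (v w : VecField n M) : VecField n M :=
  Θ.app (VectorField.mlieBracket (𝓡 n) (Θ.app v) w)
    + Θ.app (VectorField.mlieBracket (𝓡 n) v (Θ.app w))
    - VectorField.mlieBracket (𝓡 n) (Θ.app v) (Θ.app w)
    - Θ.app (Θ.app (VectorField.mlieBracket (𝓡 n) v w))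

/-- `N = 0`: the vector field `N(v, w)` vanishes for all smooth vector fields `v`, `w`. -/
def EndoField.NijenhuisVanishes [IsManifold (𝓡 n) ∞ M] (Θ : EndoField n M) : Prop :=
  ∀ v w : VecField n M, v.IsSmooth → w.IsSmooth → Θ.nijenhuis v w = 0

/-- The family of subspaces `Ker Θ^i` of the tangent spaces. -/
def EndoField.kerPow (Θ : EndoField n M) (i : ℕ) (x : M) :
    Submodule ℝ (TangentSpace (𝓡 n) x) :=
  LinearMap.ker ((Θ x) ^ i).toLinearMap

/-- A distribution is integrable (tangent to a foliation) if around each point there is a chart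
of the smooth structure in which it becomes a constant subspace `W` of `ℝⁿ`; the integral
manifolds are then, locally, the preimages of the translates of `W`. -/
def IsIntegrableDistribution (D : (x : M) → Submodule ℝ (TangentSpace (𝓡 n) x)) : Prop :=
  ∀ x : M, ∃ e ∈ IsManifold.maximalAtlas (𝓡 n) ∞ M, x ∈ e.source ∧
    ∃ W : Submodule ℝ (EuclideanSpace ℝ (Fin n)),
      ∀ y ∈ e.source, ∀ v : TangentSpace (𝓡 n) y,
        v ∈ D y ↔ (mfderiv (𝓡 n) (𝓡 n) e y v : EuclideanSpace ℝ (Fin n)) ∈ W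

/-- Around each point there is a commuting smooth local frame `e_1, …, e_n` in which `Θ` has
Jordan normal form: `Θ e_1 = 0`, and `Θ e_i = 0` or `Θ e_i = e_{i-1}` if `i > 1`. (Indices start
at `0` here, and which alternative holds depends on `i` only, not on the point.) -/
def EndoField.HasCommutingJordanFrames [IsManifold (𝓡 n) ∞ M] (Θ : EndoField n M) : Prop :=
  ∀ x : M, ∃ U : Set M, IsOpen U ∧ x ∈ U ∧ ∃ e : Fin n → VecField n M,
    IsLocalFrameOn (𝓡 n) (EuclideanSpace ℝ (Fin n)) ∞ e U ∧
    (∀ i j, ∀ y ∈ U, VectorField.mlieBracket (𝓡 n) (e i) (e j) y = 0) ∧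
    ∀ i : Fin n, (∀ y ∈ U, Θ y (e i y) = 0) ∨
      ∃ j : Fin n, (j : ℕ) + 1 = (i : ℕ) ∧ ∀ y ∈ U, Θ y (e i y) = e j y

/-- `Θ` is locally constant: around each point there is a chart of the smooth structure in which
the components of `Θ` form a constant matrix, that is, `Θ` becomes a constant endomorphism `A`
of `ℝⁿ`. -/
def EndoField.LocallyConstant (Θ : EndoField n M) : Prop :=
  ∀ x : M, ∃ e ∈ IsManifold.maximalAtlas (𝓡 n) ∞ M, x ∈ e.source ∧
    ∃ A : EuclideanSpace ℝ (Fin n) →L[ℝ] EuclideanSpace ℝ (Fin n),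
      ∀ y ∈ e.source, ∀ v : TangentSpace (𝓡 n) y,
        (mfderiv (𝓡 n) (𝓡 n) e y (Θ y v) : EuclideanSpace ℝ (Fin n)) =
          A (mfderiv (𝓡 n) (𝓡 n) e y v : EuclideanSpace ℝ (Fin n))

/-- `Θ` is integrable: `∇Θ = 0` for some smooth torsion-free connection `∇` on `TM`, where
`(∇_u Θ) v = ∇_u (Θ v) - Θ (∇_u v)`. (`cov v x u` is Mathlib's order of arguments
for `∇_u v` at `x`.) -/
def EndoField.Integrable [IsManifold (𝓡 n) ∞ M] (Θ : EndoField n M) : Prop :=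
  ∃ cov : CovariantDerivative (𝓡 n) (EuclideanSpace ℝ (Fin n))
      (TangentSpace (𝓡 n) : M → Type _),
    cov.ContMDiffCovariantDerivative ∞ ∧ cov.torsion = 0 ∧
    ∀ v : VecField n M, v.IsSmooth → ∀ (x : M) (u : TangentSpace (𝓡 n) x),
      cov (Θ.app v) x u - Θ x (cov v x u) = 0

end NilpotentTensor

end

/-! All conditions are compared with (iii). The substance is `exists_normal_form`: if N = 0 and
every Ker Θ^k is involutive, then Θ is constant in suitable coordinates. Both (i) and (iv) supply
these two facts. Sections of an integrable distribution are closed under brackets; and for a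
torsion-free ∇ with ∇Θ = 0 brackets are differences of covariant derivatives, which commute with Θ.

Work in a chart near x₀ and put A = Θ(x₀). Wanted is a map F with dF(x₀) = id and dF ∘ Θ = A ∘ dF.
It is found by descending induction on k from a weaker requirement: A^k dF Θ = A^(k+1) dF, and A^k
dF kills Ker Θ^k. Nilpotency starts the induction with F = id, and k = 0 is the goal.

To pass from k+1 to k (`IsPartialNormalForm.exists_pred`), let y = A^(k+1) F and D = Im Θ + Ker Θ^k.
The form β(Θv + w) = dy(v), for w in Ker Θ^k, is well defined on D because dy kills Ker Θ^(k+1). The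
hypotheses make D involutive and β closed along D (`bracket_image_add_ker`, `hessian_identity`). D
has constant rank because algebraic constancy provides a smooth moving frame conjugating Θ to A
(`exists_moving_frame`). A Frobenius theorem with primitives (`exists_primitive_along`) then yields
γ with dγ = β - A^k dF along D, and F + ργ is the next map, where ρ is a right inverse of A^k on Ker
A ∩ Im A^k.

The Frobenius theorem rests on the joint flow of commuting fields (`exists_commuting_flow`),
obtained from the inverse function theorem on a Banach space of paths.

Between (ii) and (iii): a Jordan basis of the constant matrix is a commuting frame, and conversely a
commuting frame is a coordinate frame. For (iii) ⇒ (iv), flat chart connections are averaged by a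
partition of unity; being torsion-free and making Θ parallel are affine conditions on the
connection. -/

open scoped Manifold ContDiff Bundle Topology

noncomputable section

namespace NilpotentTensor

/-! ### Smoothness of the composition operator on spaces of continuous maps. -/

section Composition

universe u

variable {K : Type*} [TopologicalSpace K] [CompactSpace K]
  {P Q : Type u} [NormedAddCommGroup P] [NormedSpace ℝ P] [NormedAddCommGroup Q] [NormedSpace ℝ Q]

/-- The pointwise version of a continuous bilinear map, on continuous maps. -/
def pointwiseBilin (K : Type*) [TopologicalSpace K] [CompactSpace K]
    {A P Q : Type*} [NormedAddCommGroup A] [NormedSpace ℝ A] [NormedAddCommGroup P]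
    [NormedSpace ℝ P] [NormedAddCommGroup Q] [NormedSpace ℝ Q] (B : A →L[ℝ] P →L[ℝ] Q) :
    C(K, A) →L[ℝ] C(K, P) →L[ℝ] C(K, Q) :=
  LinearMap.mkContinuous₂
    (LinearMap.mk₂ ℝ (fun (a : C(K, A)) (h : C(K, P)) =>
        (⟨fun t => B (a t) (h t), by fun_prop⟩ : C(K, Q)))
      (fun _ _ _ => by ext; simp) (fun _ _ _ => by ext; simp)
      (fun _ _ _ => by ext; simp) (fun _ _ _ => by ext; simp)) ‖B‖
    (fun a h => by
      refine (ContinuousMap.norm_le _ (by positivity)).2 fun t => ?_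
      refine (B.le_opNorm₂ _ _).trans ?_
      gcongr
      · exact a.norm_coe_le_norm t
      · exact h.norm_coe_le_norm t)

instance normedAddCommGroupContinuousMapCLM : NormedAddCommGroup C(K, P →L[ℝ] Q) :=
  ContinuousMap.instNormedAddCommGroup

instance seminormedAddCommGroupContinuousMapCLM : SeminormedAddCommGroup C(K, P →L[ℝ] Q) :=
  normedAddCommGroupContinuousMapCLM.toSeminormedAddCommGroup

instance normedSpaceContinuousMapCLM : NormedSpace ℝ C(K, P →L[ℝ] Q) :=
  ContinuousMap.normedSpace

/-- Pointwise application of a continuous family of operators to a continuous map. -/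
def pointwiseApply (K : Type*) [TopologicalSpace K] [CompactSpace K]
    (P Q : Type u) [NormedAddCommGroup P] [NormedSpace ℝ P]
    [NormedAddCommGroup Q] [NormedSpace ℝ Q] :
    C(K, P →L[ℝ] Q) →L[ℝ] C(K, P) →L[ℝ] C(K, Q) :=
  pointwiseBilin K (ContinuousLinearMap.id ℝ (P →L[ℝ] Q))

@[simp]
lemma pointwiseApply_apply (A : C(K, P →L[ℝ] Q)) (h : C(K, P)) (t : K) :
    pointwiseApply K P Q A h t = A t (h t) := rfl

/-- `f'` is uniformly continuous near the compact range of `γ`, so one δ serves for all points of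
`K`, and the mean value inequality bounds the remainder uniformly. -/
lemma hasFDerivAt_comp_continuousMap {f : P → Q} {f' : P → P →L[ℝ] Q}
    (hf : ∀ x, HasFDerivAt f (f' x) x) (hf' : Continuous f') (hfc : Continuous f) (γ : C(K, P)) :
    HasFDerivAt (fun γ : C(K, P) => (⟨f, hfc⟩ : C(P, Q)).comp γ)
      (pointwiseApply K P Q ((⟨f', hf'⟩ : C(P, P →L[ℝ] Q)).comp γ)) γ := by
  rw [hasFDerivAt_iff_isLittleO_nhds_zero, Asymptotics.isLittleO_iff]
  intro c hc
  have hK : IsCompact (Set.range γ) := isCompact_range γ.continuous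
  have := hK.uniformContinuousAt_of_continuousAt f' (fun a _ => hf'.continuousAt)
    (Metric.dist_mem_uniformity hc)
  obtain ⟨δ, hδ, H⟩ := Metric.mem_uniformity_dist.1 this
  filter_upwards [Metric.ball_mem_nhds (0 : C(K, P)) hδ] with h hh
  rw [mem_ball_zero_iff] at hh
  refine (ContinuousMap.norm_le _ (by positivity)).2 fun t => ?_
  have hb := (convex_ball (γ t) δ).norm_image_sub_le_of_norm_hasFDerivWithin_le'
    (f := f) (f' := f') (φ := f' (γ t)) (C := c) (x := γ t) (y := γ t + h t)
    (fun x _ => (hf x).hasFDerivWithinAt)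
    (fun x hx => by
      have := H (a := γ t) (b := x) (by rw [dist_comm]; exact hx) ⟨t, rfl⟩
      simp only [Set.mem_ofPred_eq] at this
      rw [← dist_eq_norm, dist_comm]; exact this.le)
    (Metric.mem_ball_self hδ)
    (by rw [mem_ball_iff_norm]; simpa using (h.norm_coe_le_norm t).trans_lt hh)
  simp only [add_sub_cancel_left] at hb
  exact hb.trans (mul_le_mul_of_nonneg_left (h.norm_coe_le_norm t) hc.le)

/-- The derivative of composition with `f` is composition with `fderiv ℝ f` followed by a continuous
linear map, so induction on `k` works once the target `Q` is allowed to vary. -/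
lemma contDiff_comp_continuousMap_nat (k : ℕ) : ∀ {Q : Type u} [NormedAddCommGroup Q]
    [NormedSpace ℝ Q] {f : P → Q} (hf : ContDiff ℝ ∞ f),
    ContDiff ℝ k (fun γ : C(K, P) => (⟨f, hf.continuous⟩ : C(P, Q)).comp γ) := by
  induction k with
  | zero =>
    intro Q _ _ f hf
    exact contDiff_zero.2 (ContinuousMap.continuous_postcomp _)
  | succ k ih =>
    intro Q _ _ f hf
    have hf' : ContDiff ℝ ∞ (fderiv ℝ f) := hf.fderiv_right (by simp)
    refine contDiff_succ_iff_hasFDerivAt.2 ⟨_, ?_, fun γ =>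
      hasFDerivAt_comp_continuousMap (f' := fderiv ℝ f)
        (fun x => (hf.differentiable (by simp) x).hasFDerivAt) hf'.continuous hf.continuous γ⟩
    exact (pointwiseApply K P Q).contDiff.comp (ih hf')

/-- The composition operator of a smooth map is smooth on continuous maps. -/
lemma contDiff_comp_continuousMap {f : P → Q} (hf : ContDiff ℝ ∞ f) :
    ContDiff ℝ ∞ (fun γ : C(K, P) => (⟨f, hf.continuous⟩ : C(P, Q)).comp γ) :=
  contDiff_infty.2 fun k => contDiff_comp_continuousMap_nat k hf

end Composition

/-! ### Local inverses that are smooth on an open set. -/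

section LocalInverse

variable {E F : Type*} [NormedAddCommGroup E] [NormedSpace ℝ E] [CompleteSpace E]
  [NormedAddCommGroup F] [NormedSpace ℝ F]

/-- Inverse function theorem, with smoothness of the inverse on an open set. -/
lemma exists_smooth_openPartialHomeomorph {f : E → F} {a : E}
    (hf : ∀ᶠ x in 𝓝 a, ContDiffAt ℝ ∞ f x) {e : E ≃L[ℝ] F}
    (he : HasFDerivAt f (e : E →L[ℝ] F) a) {s : Set E} (hs : s ∈ 𝓝 a) :
    ∃ R : OpenPartialHomeomorph E F, a ∈ R.source ∧ (R : E → F) = f ∧ R.source ⊆ s ∧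
      (∀ x ∈ R.source, ContDiffAt ℝ ∞ f x ∧ ∃ e' : E ≃L[ℝ] F, HasFDerivAt f (e' : E →L[ℝ] F) x) ∧
      ∀ y ∈ R.target, ContDiffAt ℝ ∞ R.symm y := by
  have hfa : ContDiffAt ℝ ∞ f a := hf.self_of_nhds
  have hcont : ContinuousAt (fderiv ℝ f) a := by
    have : ContDiffAt ℝ 0 (fderiv ℝ f) a := hfa.fderiv_right (m := 0) (by simp)
    exact this.continuousAt
  have hinv : ∀ᶠ x in 𝓝 a, fderiv ℝ f x ∈ Set.range ((↑) : (E ≃L[ℝ] F) → E →L[ℝ] F) := by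
    apply hcont.eventually_mem
    rw [he.fderiv]
    exact ContinuousLinearEquiv.nhds e
  obtain ⟨t, hts, hto, hat⟩ := mem_nhds_iff.1 (Filter.inter_mem (hf.and hinv) hs)
  let R := (hfa.toOpenPartialHomeomorph f he (by simp)).restrOpen t hto
  have hsrc : ∀ x ∈ R.source,
      ContDiffAt ℝ ∞ f x ∧ ∃ e' : E ≃L[ℝ] F, HasFDerivAt f (e' : E →L[ℝ] F) x := by
    intro x hx
    have hxt := hts hx.2
    obtain ⟨e', he'⟩ := hxt.1.2
    refine ⟨hxt.1.1, e', ?_⟩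
    rw [he']
    exact (hxt.1.1.differentiableAt (by simp)).hasFDerivAt
  refine ⟨R, ⟨hfa.mem_toOpenPartialHomeomorph_source he (by simp), hat⟩, rfl,
    fun x hx => (hts hx.2).2, hsrc, fun y hy => ?_⟩
  obtain ⟨h1, e', h2⟩ := hsrc _ (R.map_target hy)
  exact R.contDiffAt_symm hy h2 h1

end LocalInverse

/-! ### Globalising smooth germs. -/

section Cutoff

variable {E F : Type*} [NormedAddCommGroup E] [NormedSpace ℝ E] [FiniteDimensional ℝ E]
  [NormedAddCommGroup F] [NormedSpace ℝ F]

/-- Multiply by a bump function supported well inside the ball where `f` is smooth. This lets the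
flow theorem assume globally smooth fields. -/
lemma exists_contDiff_eventuallyEq {f : E → F} {a : E}
    (hf : ∀ᶠ x in 𝓝 a, ContDiffAt ℝ ∞ f x) :
    ∃ g : E → F, ContDiff ℝ ∞ g ∧ g =ᶠ[𝓝 a] f := by
  obtain ⟨r, hr, H⟩ := Metric.eventually_nhds_iff_ball.1 hf
  let b : ContDiffBump a := ⟨r / 3, r / 2, by positivity, by linarith⟩
  refine ⟨fun x => b x • f x, contDiff_iff_contDiffAt.2 fun x => ?_, ?_⟩
  · by_cases hx : x ∈ Metric.ball a r
    · exact b.contDiff.contDiffAt.smul (H x hx)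
    · have h0 : (fun x => b x • f x) =ᶠ[𝓝 x] fun _ => 0 := by
        have hx' : x ∉ tsupport b := by
          rw [b.tsupport_eq, Metric.mem_closedBall]
          rw [Metric.mem_ball, not_lt] at hx
          simp only [b]; linarith
        filter_upwards [(isClosed_tsupport b).isOpen_compl.mem_nhds hx'] with y hy
        rw [image_eq_zero_of_notMem_tsupport hy, zero_smul]
      exact contDiffAt_const.congr_of_eventuallyEq h0
  · filter_upwards [b.eventuallyEq_one] with x hx
    simp [hx]

end Cutoff

/-! ### Integration as an operator on paths. -/

section Primitive

variable {S : Type*} [NormedAddCommGroup S] [NormedSpace ℝ S]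

/-- Integration from `0` to `t` on continuous maps on the unit interval. -/
def primitive (S : Type*) [NormedAddCommGroup S] [NormedSpace ℝ S] :
    C(unitInterval, S) →L[ℝ] C(unitInterval, S) :=
  LinearMap.mkContinuous
    { toFun := fun γ => ⟨fun t => ∫ τ in (0 : ℝ)..t, γ (Set.projIcc 0 1 zero_le_one τ), by
        refine (intervalIntegral.continuous_primitive (fun a b => ?_) 0).comp
          continuous_subtype_val
        exact (γ.continuous.comp continuous_projIcc).intervalIntegrable _ _⟩
      map_add' := fun γ γ' => by
        ext t
        exact intervalIntegral.integral_add
          ((γ.continuous.comp continuous_projIcc).intervalIntegrable _ _)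
          ((γ'.continuous.comp continuous_projIcc).intervalIntegrable _ _)
      map_smul' := fun c γ => by
        ext t
        exact intervalIntegral.integral_smul _ _ } 1
    (fun γ => by
      refine (ContinuousMap.norm_le _ (by positivity)).2 fun t => ?_
      refine (intervalIntegral.norm_integral_le_of_norm_le_const (C := ‖γ‖)
        fun τ _ => γ.norm_coe_le_norm _).trans ?_
      rw [sub_zero, abs_of_nonneg t.2.1, mul_comm]
      exact mul_le_mul_of_nonneg_right t.2.2 (norm_nonneg _))

lemma primitive_apply (γ : C(unitInterval, S)) (t : unitInterval) :
    primitive S γ t = ∫ τ in (0 : ℝ)..t, γ (Set.projIcc 0 1 zero_le_one τ) := rfl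

lemma primitive_of_hasDerivAt [CompleteSpace S] {v : ℝ → S} {v' : C(unitInterval, S)}
    (h : ∀ t : unitInterval, HasDerivAt v (v' t) t) (t : unitInterval) :
    primitive S v' t = v t - v 0 := by
  rw [primitive_apply]
  refine intervalIntegral.integral_eq_sub_of_hasDerivAt (fun τ hτ => ?_)
    ((v'.continuous.comp continuous_projIcc).intervalIntegrable _ _)
  rw [Set.uIcc_of_le t.2.1] at hτ
  have hτ' : τ ∈ Set.Icc (0 : ℝ) 1 := ⟨hτ.1, hτ.2.trans t.2.2⟩
  simp only [Set.projIcc_of_mem _ hτ']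
  exact h ⟨τ, hτ'⟩

/-- The primitive, extended to all real times, has the expected derivative on `[0, 1]` if the
integrand is extended by constants. -/
lemma hasDerivAt_primitive [CompleteSpace S] (γ : C(unitInterval, S)) (t : unitInterval) :
    HasDerivAt (fun s : ℝ => ∫ τ in (0 : ℝ)..s, γ (Set.projIcc 0 1 zero_le_one τ)) (γ t) t := by
  have hc : Continuous fun τ : ℝ => γ (Set.projIcc 0 1 zero_le_one τ) :=
    γ.continuous.comp continuous_projIcc
  have := intervalIntegral.integral_hasDerivAt_right (hc.intervalIntegrable 0 (t : ℝ))
    (hc.stronglyMeasurableAtFilter _ _) hc.continuousAt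
  simpa using this

end Primitive

/-! ### Joint flows of commuting vector fields. -/

section Flow

universe u

open unitInterval

variable {D S : Type u} [NormedAddCommGroup D] [NormedSpace ℝ D]
  [NormedAddCommGroup S] [NormedSpace ℝ S]

/-- Constant paths. -/
def constPath (S : Type*) [NormedAddCommGroup S] [NormedSpace ℝ S] : S →L[ℝ] C(I, S) :=
  LinearMap.mkContinuous
    { toFun := fun s => ContinuousMap.const I s
      map_add' := fun _ _ => rfl
      map_smul' := fun _ _ => rfl } 1
    (fun s => (ContinuousMap.norm_le _ (by positivity)).2 fun _ => (one_mul ‖s‖).ge)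

@[simp]
lemma constPath_apply (s : S) (t : I) : constPath S s t = s := rfl

/-- The path `t ↦ (γ t, x)`, for a path `γ` and a parameter `x`. -/
def pathWithParameter (D S : Type u) [NormedAddCommGroup D] [NormedSpace ℝ D]
    [NormedAddCommGroup S] [NormedSpace ℝ S] :
    ((D × S) × C(I, S)) →L[ℝ] C(I, S × D) :=
  ((ContinuousLinearMap.inl ℝ S D).compLeftContinuous ℝ I).comp
      (ContinuousLinearMap.snd ℝ (D × S) C(I, S)) +
    ((ContinuousLinearMap.inr ℝ S D).compLeftContinuous ℝ I).comp
      ((constPath D).comp ((ContinuousLinearMap.fst ℝ D S).comp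
        (ContinuousLinearMap.fst ℝ (D × S) C(I, S))))

@[simp]
lemma pathWithParameter_apply (q : (D × S) × C(I, S)) (t : I) :
    pathWithParameter D S q t = (q.2 t, q.1.1) := by
  simp [pathWithParameter]

/-- The linear part of the integral equation `γ = s + ∫ f(γ) x`. -/
def pathDefect (D S : Type u) [NormedAddCommGroup D] [NormedSpace ℝ D]
    [NormedAddCommGroup S] [NormedSpace ℝ S] : ((D × S) × C(I, S)) →L[ℝ] C(I, S) :=
  ContinuousLinearMap.snd ℝ (D × S) C(I, S) -
    (constPath S).comp ((ContinuousLinearMap.snd ℝ D S).comp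
        (ContinuousLinearMap.fst ℝ (D × S) C(I, S)))

@[simp]
lemma pathDefect_apply (q : (D × S) × C(I, S)) :
    pathDefect D S q = q.2 - constPath S q.1.2 := rfl

lemma hasFDerivAt_uncurried {f : S → D →L[ℝ] S} (hf : ContDiff ℝ ∞ f) (q : S × D) :
    HasFDerivAt (fun q : S × D => f q.1 q.2)
      (((fderiv ℝ f q.1).flip q.2).comp (ContinuousLinearMap.fst ℝ S D) +
        (f q.1).comp (ContinuousLinearMap.snd ℝ S D)) q := by
  have h1 : HasFDerivAt (fun q : S × D => f q.1)
      ((fderiv ℝ f q.1).comp (ContinuousLinearMap.fst ℝ S D)) q :=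
    ((hf.differentiable (by simp) q.1).hasFDerivAt).comp q hasFDerivAt_fst
  convert! h1.clm_apply (hasFDerivAt_snd (p := q)) using 1
  ext <;> simp

/-- Commuting vector fields `f · h`, `h ∈ D`, generate a smooth local action of `D`. -/
theorem exists_commuting_flow [CompleteSpace D] [CompleteSpace S] {f : S → D →L[ℝ] S}
    (hf : ContDiff ℝ ∞ f) {s₀ : S}
    (hsymm : ∀ᶠ s in 𝓝 s₀, ∀ h₁ h₂, fderiv ℝ f s (f s h₁) h₂ = fderiv ℝ f s (f s h₂) h₁) :
    ∃ u : D × S → S, (∀ᶠ p in 𝓝 (0, s₀), ContDiffAt ℝ ∞ u p) ∧ (∀ᶠ s in 𝓝 s₀, u (0, s) = s) ∧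
      ∀ᶠ p in 𝓝 ((0 : D), s₀), ∀ h, fderiv ℝ u p (h, 0) = f (u p) h := by
  set k : S × D → S := fun q => f q.1 q.2 with hk
  have hkc : ContDiff ℝ ∞ k := (hf.comp contDiff_fst).clm_apply contDiff_snd
  set k' : S × D → (S × D →L[ℝ] S) := fun q =>
    ((fderiv ℝ f q.1).flip q.2).comp (ContinuousLinearMap.fst ℝ S D) +
        (f q.1).comp (ContinuousLinearMap.snd ℝ S D) with hk'
  have hkk' : ∀ q, HasFDerivAt k (k' q) q := hasFDerivAt_uncurried hf
  have hk'c : Continuous k' := by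
    have : k' = fderiv ℝ k := funext fun q => (hkk' q).fderiv.symm
    rw [this]
    exact hkc.continuous_fderiv (by simp)
  -- For parameters `(x, s)`, the zeros of `Φ` are the solutions on [0, 1] of γ' = f(γ) x with γ(0)
  -- = s.
  set Φ : (D × S) × C(I, S) → C(I, S) := fun q =>
    pathDefect D S q -
      primitive S ((⟨k, hkc.continuous⟩ : C(S × D, S)).comp (pathWithParameter D S q)) with hΦ
  set Φ' : (D × S) × C(I, S) → ((D × S) × C(I, S) →L[ℝ] C(I, S)) := fun q =>
    pathDefect D S -
      (primitive S).comp ((pointwiseApply I (S × D) S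
        ((⟨k', hk'c⟩ : C(S × D, S × D →L[ℝ] S)).comp (pathWithParameter D S q))).comp
        (pathWithParameter D S)) with hΦ'
  have hΦΦ' : ∀ q, HasFDerivAt Φ (Φ' q) q := fun q => by
    refine (pathDefect D S).hasFDerivAt.sub ?_
    refine (primitive S).hasFDerivAt.comp q ?_
    exact (hasFDerivAt_comp_continuousMap hkk' hk'c hkc.continuous _).comp q
      (pathWithParameter D S).hasFDerivAt
  have hΦc : ContDiff ℝ ∞ Φ :=
    (pathDefect D S).contDiff.sub ((primitive S).contDiff.comp
      ((contDiff_comp_continuousMap hkc).comp (pathWithParameter D S).contDiff))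
  set G : (D × S) × C(I, S) → (D × S) × C(I, S) := fun q => (q.1, Φ q) with hG
  have hGc : ContDiff ℝ ∞ G := contDiff_fst.prodMk hΦc
  have hGG' : ∀ q, HasFDerivAt G ((ContinuousLinearMap.fst ℝ (D × S) C(I, S)).prod (Φ' q)) q :=
    fun q => hasFDerivAt_fst.prodMk (hΦΦ' q)
  set q₀ : (D × S) × C(I, S) := ((0, s₀), constPath S s₀) with hq₀
  -- At the base point x = 0, so the integrand does not respond to γ. The derivative of `G` is
  -- therefore triangular with identity diagonal; `T` is its off-diagonal entry.
  let T : (D × S) →L[ℝ] C(I, S) :=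
    -((constPath S).comp (ContinuousLinearMap.snd ℝ D S)) -
      (primitive S).comp ((constPath S).comp ((f s₀).comp (ContinuousLinearMap.fst ℝ D S)))
  let e : ((D × S) × C(I, S)) ≃L[ℝ] (D × S) × C(I, S) :=
    (ContinuousLinearEquiv.refl ℝ (D × S)).skewProd (ContinuousLinearEquiv.refl ℝ C(I, S)) T
  have he : HasFDerivAt G (e : ((D × S) × C(I, S)) →L[ℝ] (D × S) × C(I, S)) q₀ := by
    convert! hGG' q₀ using 1
    refine ContinuousLinearMap.ext fun q => Prod.ext rfl ?_
    have h1 : (pointwiseApply I (S × D) S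
        ((⟨k', hk'c⟩ : C(S × D, S × D →L[ℝ] S)).comp (pathWithParameter D S q₀)))
          (pathWithParameter D S q) = constPath S (f s₀ q.1.1) := by
      ext t
      simp [hk', hq₀]
    change q.2 + T q.1 = pathDefect D S q - primitive S (pointwiseApply I (S × D) S
        ((⟨k', hk'c⟩ : C(S × D, S × D →L[ℝ] S)).comp (pathWithParameter D S q₀))
          (pathWithParameter D S q))
    rw [h1]
    simp only [T, pathDefect_apply, sub_apply, neg_apply,
      ContinuousLinearMap.comp_apply, ContinuousLinearMap.coe_fst', ContinuousLinearMap.coe_snd']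
    abel
  obtain ⟨R, hR₀, hRG, -, hRs, hRt⟩ := exists_smooth_openPartialHomeomorph
    (Filter.Eventually.of_forall fun q => hGc.contDiffAt) he Filter.univ_mem
  have hΦ0 : ∀ s : S, G ((0, s), constPath S s) = ((0, s), 0) := fun s => by
    refine Prod.ext rfl ?_
    change pathDefect D S _ - primitive S _ = 0
    have : (⟨k, hkc.continuous⟩ : C(S × D, S)).comp
        (pathWithParameter D S ((0, s), constPath S s)) = 0 := by
      ext t; simp [hk]
    rw [this]; simp
  let j : D × S → (D × S) × C(I, S) := fun p => (p, 0)
  have hj : Continuous j := by fun_prop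
  have hjc : ContDiff ℝ ∞ j := contDiff_id.prodMk contDiff_const
  have hj₀ : j (0, s₀) ∈ R.target := by
    have := R.map_source hR₀
    rwa [hRG, hΦ0] at this
  have hjt : ∀ᶠ p in 𝓝 ((0 : D), s₀), j p ∈ R.target :=
    hj.continuousAt.eventually_mem (R.open_target.mem_nhds hj₀)
  let ev : ((D × S) × C(I, S)) →L[ℝ] S :=
    (ContinuousMap.evalCLM ℝ (1 : I)).comp (ContinuousLinearMap.snd ℝ (D × S) C(I, S))
  -- `u (x, s)` is the time-one value of the solution with parameter `x` starting at `s`.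
  refine ⟨fun p => ev (R.symm (j p)), ?_, ?_, ?_⟩
  · filter_upwards [hjt] with p hp
    exact ev.contDiff.contDiffAt.comp p ((hRt _ hp).comp p hjc.contDiffAt)
  · have hc : Continuous fun s : S => (((0 : D), s), constPath S s) := by fun_prop
    filter_upwards [hc.continuousAt.eventually_mem (R.open_source.mem_nhds hR₀)] with s hs
    have : R.symm (j (0, s)) = ((0, s), constPath S s) := by
      rw [← R.left_inv hs, hRG, hΦ0]
    rw [this]; rfl
  -- Commutation is needed along the whole solution path; sup-norm continuity keeps the path in the
  -- ball where it holds.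
  · have hclose : ∀ᶠ p in 𝓝 ((0 : D), s₀), ∀ t : I, ∀ h₁ h₂,
        fderiv ℝ f ((R.symm (j p)).2 t) (f ((R.symm (j p)).2 t) h₁) h₂ =
          fderiv ℝ f ((R.symm (j p)).2 t) (f ((R.symm (j p)).2 t) h₂) h₁ := by
      obtain ⟨δ, hδ, H⟩ := Metric.eventually_nhds_iff_ball.1 hsymm
      have hcont : ContinuousAt (fun p => (R.symm (j p)).2) ((0 : D), s₀) :=
        ((R.continuousAt_symm hj₀).comp hj.continuousAt).snd
      have h0 : (R.symm (j (0, s₀))).2 = constPath S s₀ := by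
        have : j (0, s₀) = R q₀ := by rw [hRG, hΦ0]
        rw [this, R.left_inv hR₀]
      filter_upwards [hcont.eventually_mem (Metric.ball_mem_nhds _ hδ)] with p hp t
      refine H _ ?_
      rw [h0] at hp
      exact (ContinuousMap.dist_apply_le_dist t).trans_lt hp
    filter_upwards [hjt, hclose] with p hp hsym h
    obtain ⟨hqc, e', he'⟩ := hRs _ (R.map_target hp)
    set q := R.symm (j p) with hq
    have hGq : G q = (p, 0) := by rw [← hRG]; exact R.right_inv hp
    have hq1 : q.1 = p := congrArg Prod.fst hGq
    have hΦq : Φ q = 0 := congrArg Prod.snd hGq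
    set γ := q.2 with hγ
    let x : D := p.1
    -- the integral equation
    let w : C(I, S) := (⟨k, hkc.continuous⟩ : C(S × D, S)).comp (pathWithParameter D S q)
    have hw : ∀ t, w t = f (γ t) x := fun t => by simp [w, hk, x, ← hq1, hγ]
    let γt : ℝ → S := fun s => p.2 + ∫ τ in (0 : ℝ)..s, w (Set.projIcc 0 1 zero_le_one τ)
    have hγt : ∀ t : I, γt t = γ t := fun t => by
      have := congrArg (fun c : C(I, S) => c t) hΦq
      simp only [hΦ, pathDefect_apply, ContinuousMap.sub_apply, constPath_apply,
        ContinuousMap.zero_apply] at this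
      rw [hq1] at this
      have h2 : γ t - p.2 - primitive S w t = 0 := this
      rw [primitive_apply] at h2
      simp only [γt]
      rw [sub_sub, sub_eq_zero] at h2
      exact h2.symm
    have hγd : ∀ t : I, HasDerivAt γt (f (γ t) x) t := fun t => by
      rw [← hw]
      exact (hasDerivAt_primitive w t).const_add _
    -- The variation of γ in the direction `h`. Commutation is exactly what makes t · f(γ) h solve
    -- the linearised equation v' = Df(γ)(v) x + f(γ) h with v(0) = 0; its value at t = 1 is the
    -- asserted derivative.
    let v : C(I, S) := ⟨fun t => (t : ℝ) • f (γ t) h, by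
      have := hf.continuous
      fun_prop⟩
    let v' : C(I, S) := pointwiseApply I (S × D) S
        ((⟨k', hk'c⟩ : C(S × D, S × D →L[ℝ] S)).comp (pathWithParameter D S q))
          (pathWithParameter D S ((h, 0), v))
    have hv' : ∀ t, v' t = fderiv ℝ f (γ t) (v t) x + f (γ t) h := fun t => by
      simp [v', hk', x, ← hq1, hγ]
    have hvd : ∀ t : I, HasDerivAt (fun s : ℝ => s • f (γt s) h) (v' t) t := fun t => by
      have h1 : HasFDerivAt f (fderiv ℝ f (γ t)) (γt t) := by
        rw [hγt]; exact (hf.differentiable (by simp) _).hasFDerivAt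
      have h2 : HasDerivAt (fun s => f (γt s)) (fderiv ℝ f (γ t) (f (γ t) x)) t :=
        h1.comp_hasDerivAt _ (hγd t)
      have h3 := h2.clm_apply (hasDerivAt_const (t : ℝ) h)
      have h4 := (hasDerivAt_id (t : ℝ)).smul h3
      convert! h4 using 1
      rw [hv', hγt, hsym t x h]
      simp [v]
    have hint : primitive S v' = v := by
      ext t
      rw [primitive_of_hasDerivAt hvd t]
      simp [v, hγt]
    have hev : e' ((h, 0), v) = ((h, 0), 0) := by
      have : (e' : ((D × S) × C(I, S)) →L[ℝ] (D × S) × C(I, S)) =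
        (ContinuousLinearMap.fst ℝ (D × S) C(I, S)).prod (Φ' q) := he'.unique (hGG' q)
      rw [← ContinuousLinearEquiv.coe_coe, this]
      refine Prod.ext rfl ?_
      change pathDefect D S _ - primitive S v' = 0
      rw [hint]; simp
    have hsd : HasFDerivAt R.symm (e'.symm : (D × S) × C(I, S) →L[ℝ] (D × S) × C(I, S)) (j p) :=
      R.hasFDerivAt_symm hp (by rw [hRG]; exact he')
    have hjd : HasFDerivAt j ((ContinuousLinearMap.id ℝ (D × S)).prod 0) p :=
      (hasFDerivAt_id p).prodMk (hasFDerivAt_const _ _)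
    have := ev.hasFDerivAt.comp p (hsd.comp p hjd)
    change fderiv ℝ (ev ∘ (R.symm ∘ j)) p (h, 0) = _
    rw [this.fderiv]
    have h5 : e'.symm ((h, 0), 0) = ((h, 0), v) := by rw [← hev, e'.symm_apply_apply]
    change ev (e'.symm ((h, 0), 0)) = _
    rw [h5]
    change (1 : ℝ) • f (γ 1) h = f (γ 1) h
    rw [one_smul]

end Flow

/-! ### Frobenius theorem and primitives along a foliation. -/

section Frobenius

universe u

variable {V D C W : Type u}
  [NormedAddCommGroup V] [NormedSpace ℝ V] [FiniteDimensional ℝ V]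
  [NormedAddCommGroup D] [NormedSpace ℝ D] [CompleteSpace D]
  [NormedAddCommGroup C] [NormedSpace ℝ C] [CompleteSpace C]
  [NormedAddCommGroup W] [NormedSpace ℝ W] [CompleteSpace W]

omit [CompleteSpace D] [CompleteSpace C] in
/-- A family of surjective operators has a smooth frame of its kernels, normalised by `p`. -/
lemma exists_kernel_frame {X : Type*} [NormedAddCommGroup X] [NormedSpace ℝ X]
    {p : V →L[ℝ] D} {η : X → V →L[ℝ] C} {x₀ : X}
    (hη : ∀ᶠ x in 𝓝 x₀, ContDiffAt ℝ ∞ η x) (e : V ≃L[ℝ] D × C)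
    (he : ∀ v, e v = (p v, η x₀ v)) :
    ∃ m : X → D →L[ℝ] V, (∀ᶠ x in 𝓝 x₀, ContDiffAt ℝ ∞ m x) ∧
      (∀ᶠ x in 𝓝 x₀, (∀ h, p (m x h) = h) ∧ (∀ h, η x (m x h) = 0) ∧
        ∀ v, η x v = 0 → m x (p v) = v) := by
  have : CompleteSpace V := FiniteDimensional.complete ℝ V
  let T : X → V →L[ℝ] D × C := fun x => p.prod (η x)
  have hT : ∀ᶠ x in 𝓝 x₀, ContDiffAt ℝ ∞ T x := by
    filter_upwards [hη] with x hx
    have h1 : T = fun x => (ContinuousLinearMap.inl ℝ D C).comp p +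
        (ContinuousLinearMap.inr ℝ D C).comp (η x) := by
      funext x; ext v <;> simp [T]
    rw [h1]
    exact contDiffAt_const.add (contDiffAt_const.clm_comp hx)
  have hT₀ : T x₀ = e := by ext1 v; exact (he v).symm
  have hinv : ∀ᶠ x in 𝓝 x₀, T x ∈ Set.range ((↑) : (V ≃L[ℝ] D × C) → V →L[ℝ] D × C) := by
    apply hT.self_of_nhds.continuousAt.eventually_mem
    rw [hT₀]
    exact ContinuousLinearEquiv.nhds e
  refine ⟨fun x => (T x).inverse.comp (ContinuousLinearMap.inl ℝ D C), ?_, ?_⟩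
  · filter_upwards [hT, hinv] with x hx ⟨e', he'⟩
    have := (contDiffAt_map_inverse (n := ∞) e')
    rw [he'] at this
    exact (this.comp x hx).clm_comp contDiffAt_const
  · filter_upwards [hinv] with x ⟨e', he'⟩
    have h1 : ∀ v, e' v = (p v, η x v) := fun v => by
      rw [← ContinuousLinearEquiv.coe_coe, he']; rfl
    rw [← he', ContinuousLinearMap.inverse_equiv]
    have h2 : ∀ h, (p (e'.symm (h, 0)), η x (e'.symm (h, 0))) = (h, (0 : C)) := fun h => by
      rw [← h1, e'.apply_symm_apply]
    refine ⟨fun h => congrArg Prod.fst (h2 h), fun h => congrArg Prod.snd (h2 h), fun v hv => ?_⟩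
    change e'.symm (p v, 0) = v
    rw [← hv, ← h1, e'.symm_apply_apply]

omit [FiniteDimensional ℝ V] [CompleteSpace D] [CompleteSpace C] [CompleteSpace W] in
/-- Differentiating a pairing of operator-valued maps. -/
lemma fderiv_clm_comp_apply {α : V → V →L[ℝ] W} {m : V → D →L[ℝ] V} {y : V}
    (hα : DifferentiableAt ℝ α y) (hm : DifferentiableAt ℝ m y) (u : V) (h : D) :
    fderiv ℝ (fun x => α x (m x h)) y u = fderiv ℝ α y u (m y h) + α y (fderiv ℝ m y u h) := by
  rw [(hα.hasFDerivAt.clm_apply (hm.hasFDerivAt.clm_apply (hasFDerivAt_const h y))).fderiv]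
  simp [add_comm]

/-- A one-form closed along an involutive distribution `Ker η` of constant rank
has local primitives along it, with arbitrary transverse derivative at the base point. -/
theorem exists_primitive_along {p : V →L[ℝ] D} {η : V → V →L[ℝ] C} {α : V → V →L[ℝ] W} {x₀ : V}
    (hη : ∀ᶠ x in 𝓝 x₀, ContDiffAt ℝ ∞ η x) (hα : ∀ᶠ x in 𝓝 x₀, ContDiffAt ℝ ∞ α x)
    (e : V ≃L[ℝ] D × C) (he : ∀ v, e v = (p v, η x₀ v))
    (hηs : ∀ᶠ x in 𝓝 x₀, ∀ u v, η x u = 0 → η x v = 0 →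
      fderiv ℝ η x u v = fderiv ℝ η x v u)
    (hαs : ∀ᶠ x in 𝓝 x₀, ∀ u v, η x u = 0 → η x v = 0 →
      fderiv ℝ α x u v = fderiv ℝ α x v u)
    (L : V →L[ℝ] W) (hL : ∀ v, η x₀ v = 0 → L v = α x₀ v) :
    ∃ F : V → W, (∀ᶠ x in 𝓝 x₀, ContDiffAt ℝ ∞ F x) ∧
      (∀ᶠ x in 𝓝 x₀, ∀ v, η x v = 0 → fderiv ℝ F x v = α x v) ∧ fderiv ℝ F x₀ = L := by
  have : CompleteSpace V := FiniteDimensional.complete ℝ V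
  obtain ⟨m₀, hm₀, hm₀p⟩ := exists_kernel_frame hη e he
  -- The frame of Ker η is lifted to `V × W` by h ↦ (m h, α(m h)). Orbits of the lifted fields are
  -- graphs, over the leaves, of primitives of α.
  obtain ⟨g, hg, hgm⟩ := exists_contDiff_eventuallyEq
    (f := fun x => (ContinuousLinearMap.inl ℝ V W).comp (m₀ x) +
        (ContinuousLinearMap.inr ℝ V W).comp ((α x).comp (m₀ x))) (a := x₀) (by
      filter_upwards [hm₀, hα] with x h1 h2
      exact (contDiffAt_const.clm_comp h1).add (contDiffAt_const.clm_comp (h2.clm_comp h1)))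
  set m : V → D →L[ℝ] V := fun x => (ContinuousLinearMap.fst ℝ V W).comp (g x) with hm
  set b : V → D →L[ℝ] W := fun x => (ContinuousLinearMap.snd ℝ V W).comp (g x) with hb
  have hmc : ContDiff ℝ ∞ m := contDiff_const.clm_comp hg
  have hbc : ContDiff ℝ ∞ b := contDiff_const.clm_comp hg
  have hgmb : ∀ x h, g x h = (m x h, b x h) := fun x h => rfl
  have hmp : ∀ᶠ x in 𝓝 x₀, (∀ h, p (m x h) = h) ∧ (∀ h, η x (m x h) = 0) ∧
      (∀ v, η x v = 0 → m x (p v) = v) ∧ ∀ h, b x h = α x (m x h) := by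
    filter_upwards [hgm, hm₀p] with x hx hx'
    have h1 : ∀ h, m x h = m₀ x h := fun h => by simp [hm, hx]
    have h2 : ∀ h, b x h = α x (m₀ x h) := fun h => by simp [hb, hx]
    simp only [h1, h2]
    exact ⟨hx'.1, hx'.2.1, hx'.2.2, fun _ => trivial⟩
  -- the fields `g · h` commute
  have hsymm : ∀ᶠ y in 𝓝 x₀, ∀ h₁ h₂,
      fderiv ℝ g y (m y h₁) h₂ = fderiv ℝ g y (m y h₂) h₁ := by
    filter_upwards [hmp.eventually_nhds, hη, hα, hηs, hαs] with y hy hηy hαy hηsy hαsy h₁ h₂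
    obtain ⟨hp0, hη0, hv0, hb0⟩ := hy.self_of_nhds
    have hmd : DifferentiableAt ℝ m y := hmc.differentiable (by simp) y
    have hbd : DifferentiableAt ℝ b y := hbc.differentiable (by simp) y
    have hηd : DifferentiableAt ℝ η y := hηy.differentiableAt (by simp)
    have hαd : DifferentiableAt ℝ α y := hαy.differentiableAt (by simp)
    have hgd : ∀ u h, fderiv ℝ g y u h = (fderiv ℝ m y u h, fderiv ℝ b y u h) := fun u h => by
      have hgd := (hg.differentiable (by simp) y).hasFDerivAt
      have h1 : fderiv ℝ m y u = (ContinuousLinearMap.fst ℝ V W).comp (fderiv ℝ g y u) := by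
        rw [((hasFDerivAt_const (ContinuousLinearMap.fst ℝ V W) y).clm_comp hgd).fderiv]
        simp
      have h2 : fderiv ℝ b y u = (ContinuousLinearMap.snd ℝ V W).comp (fderiv ℝ g y u) := by
        rw [((hasFDerivAt_const (ContinuousLinearMap.snd ℝ V W) y).clm_comp hgd).fderiv]
        simp
      rw [h1, h2]; rfl
    have hp1 : ∀ u h, p (fderiv ℝ m y u h) = 0 := fun u h => by
      have h1 : fderiv ℝ (fun x => p (m x h)) y = 0 := by
        have : (fun x => p (m x h)) =ᶠ[𝓝 y] fun _ => h := hy.mono fun x hx => hx.1 h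
        rw [this.fderiv_eq, fderiv_const_apply]
      have h2 := (p.hasFDerivAt.comp y (hmd.hasFDerivAt.clm_apply (hasFDerivAt_const h y))).fderiv
      change fderiv ℝ (fun x => p (m x h)) y = _ at h2
      rw [h1] at h2
      simpa using (DFunLike.congr_fun h2 u).symm
    have hη1 : ∀ u h, fderiv ℝ η y u (m y h) + η y (fderiv ℝ m y u h) = 0 := fun u h => by
      have : (fun x => η x (m x h)) =ᶠ[𝓝 y] fun _ => 0 := hy.mono fun x hx => hx.2.1 h
      rw [← fderiv_clm_comp_apply hηd hmd, this.fderiv_eq, fderiv_const_apply]; rfl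
    have hb1 : ∀ u h, fderiv ℝ b y u h =
        fderiv ℝ α y u (m y h) + α y (fderiv ℝ m y u h) := fun u h => by
      have : (fun x => b x h) =ᶠ[𝓝 y] fun x => α x (m x h) := hy.mono fun x hx => hx.2.2.2 h
      rw [← fderiv_clm_comp_apply hαd hmd, ← this.fderiv_eq,
        (hbd.hasFDerivAt.clm_apply (hasFDerivAt_const h y)).fderiv]
      simp
    -- The bracket of two frame fields lies in Ker η by closedness of η there, and its `p`-component
    -- is zero because the frame is normalised by `p`; hence it vanishes.
    have hm1 : fderiv ℝ m y (m y h₁) h₂ = fderiv ℝ m y (m y h₂) h₁ := by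
      rw [← sub_eq_zero, ← hv0 (_ - _), map_sub, hp1, hp1, sub_zero, map_zero]
      rw [map_sub, eq_neg_of_add_eq_zero_right (hη1 _ _), eq_neg_of_add_eq_zero_right (hη1 _ _),
        hηsy _ _ (hη0 h₁) (hη0 h₂), sub_self]
    rw [hgd, hgd, hb1, hb1, hm1, hαsy _ _ (hη0 h₁) (hη0 h₂)]
  -- the flow
  have hfc : ContDiff ℝ ∞ fun s : V × W => g s.1 := hg.comp contDiff_fst
  have hfst : Filter.Tendsto (Prod.fst : V × W → V) (𝓝 (x₀, 0)) (𝓝 x₀) := continuousAt_fst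
  obtain ⟨φ, hφc, hφ0, hφd⟩ := exists_commuting_flow (s₀ := ((x₀, 0) : V × W)) hfc (by
    filter_upwards [hfst.eventually hsymm] with s hs h₁ h₂
    have : fderiv ℝ (fun s : V × W => g s.1) s =
        (fderiv ℝ g s.1).comp (ContinuousLinearMap.fst ℝ V W) :=
      ((hg.differentiable (by simp) s.1).hasFDerivAt.comp s hasFDerivAt_fst).fderiv
    rw [this]
    exact hs h₁ h₂)
  -- `ι` parametrises a transversal through x₀. Flowing from it gives the straightening `Ψ` in the
  -- first component and the primitive, with initial value 0, in the second.
  let ι : C →L[ℝ] V := (e.symm : D × C →L[ℝ] V).comp (ContinuousLinearMap.inr ℝ D C)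
  let i : D × C → D × (V × W) := fun q => (q.1, (x₀ + ι q.2, 0))
  let i' : D × C →L[ℝ] D × (V × W) := (ContinuousLinearMap.fst ℝ D C).prod
    ((ι.comp (ContinuousLinearMap.snd ℝ D C)).prod 0)
  have hi : ∀ q, HasFDerivAt i i' q := fun q =>
    hasFDerivAt_fst.prodMk (((ι.hasFDerivAt.comp q hasFDerivAt_snd).const_add x₀).prodMk
      (hasFDerivAt_const _ _))
  have hic : ContDiff ℝ ∞ i := contDiff_fst.prodMk
    ((contDiff_const.add (ι.contDiff.comp contDiff_snd)).prodMk contDiff_const)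
  have hi0 : i 0 = (0, (x₀, 0)) := by simp [i]
  have hit : Filter.Tendsto i (𝓝 0) (𝓝 (0, (x₀, 0))) := by
    rw [← hi0]; exact hic.continuous.continuousAt
  let Ψ : D × C → V := fun q => (φ (i q)).1
  -- The term `L (ι q.2)` is constant along leaves, so it leaves the leafwise derivative alone and
  -- prescribes the transverse derivative at x₀.
  let Z : D × C → W := fun q => (φ (i q)).2 + L (ι q.2)
  have hφ0' : φ (0, (x₀, 0)) = (x₀, 0) := hφ0.self_of_nhds
  have hm0 : ∀ h, m x₀ h = e.symm (h, 0) := fun h => by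
    obtain ⟨h1, h2, -, -⟩ := hmp.self_of_nhds
    rw [← e.symm_apply_apply (m x₀ h), he, h1, h2]
  have hφd0 : ∀ q, fderiv ℝ φ (0, (x₀, 0)) (i' q) =
      (e.symm q, α x₀ (m x₀ q.1)) := fun q => by
    have hd := (hφc.self_of_nhds.differentiableAt (by simp)).hasFDerivAt
    have h1 : fderiv ℝ φ (0, (x₀, 0)) (q.1, 0) = (m x₀ q.1, b x₀ q.1) := by
      rw [hφd.self_of_nhds, hφ0']; rfl
    have h2 : ∀ s : V × W, fderiv ℝ φ (0, (x₀, 0)) (0, s) = s := fun s => by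
      have h3 : HasFDerivAt (fun s : V × W => φ (0, s)) _ (x₀, 0) :=
        HasFDerivAt.comp (g := φ) _ hd (hasFDerivAt_prodMk_right (0 : D) ((x₀, 0) : V × W))
      have h4 : (fun s : V × W => φ (0, s)) =ᶠ[𝓝 (x₀, 0)] id := hφ0
      have h5 := (h3.congr_of_eventuallyEq h4.symm).unique (hasFDerivAt_id _)
      simpa using DFunLike.congr_fun h5 s
    have h6 : i' q = (q.1, 0) + (0, (ι q.2, 0)) := by
      simp [i']
    rw [h6, map_add, h1, h2, hmp.self_of_nhds.2.2.2, hm0]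
    refine Prod.ext ?_ (add_zero _)
    change e.symm (q.1, 0) + e.symm (0, q.2) = e.symm q
    rw [← map_add]; simp
  have hΨd0 : HasFDerivAt Ψ (e.symm : D × C →L[ℝ] V) 0 := by
    have hd := (hφc.self_of_nhds.differentiableAt (by simp)).hasFDerivAt
    rw [← hi0] at hd
    convert! (hd.comp 0 (hi 0)).fst using 1
    refine ContinuousLinearMap.ext fun q => ?_
    change _ = (fderiv ℝ φ (i 0) (i' q)).1
    rw [hi0, hφd0]; rfl
  have hφi : ∀ᶠ q in 𝓝 0, ContDiffAt ℝ ∞ (fun q => φ (i q)) q := by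
    filter_upwards [hit.eventually hφc] with q hq
    exact hq.comp q hic.contDiffAt
  obtain ⟨R, hR0, hRΨ, hRsub, hRs, hRt⟩ := exists_smooth_openPartialHomeomorph
    (f := Ψ) (a := 0) (hφi.mono fun q hq => hq.fst) hΨd0 (hit.eventually (hφc.and hφd))
  have hZc : ∀ q ∈ R.source, ContDiffAt ℝ ∞ Z q := fun q hq =>
    (((hRsub hq).1.comp q hic.contDiffAt).snd).add
      (L.contDiff.comp (ι.contDiff.comp contDiff_snd)).contDiffAt
  have hΨ0 : R 0 = x₀ := by rw [hRΨ]; change (φ (i 0)).1 = x₀; rw [hi0, hφ0']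
  have hx₀ : x₀ ∈ R.target := hΨ0 ▸ R.map_source hR0
  have hZd : ∀ q ∈ R.source, ∀ w, fderiv ℝ Z q w =
      (fderiv ℝ φ (i q) (i' w)).2 + L (ι w.2) := fun q hq w => by
    have hd := ((hRsub hq).1.differentiableAt (by simp)).hasFDerivAt
    have : HasFDerivAt Z _ q := ((hd.comp q (hi q)).snd).add
      (L.hasFDerivAt.comp q (ι.hasFDerivAt.comp q hasFDerivAt_snd))
    rw [this.fderiv]; rfl
  have hΨd : ∀ q ∈ R.source, ∀ w, fderiv ℝ Ψ q w = (fderiv ℝ φ (i q) (i' w)).1 :=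
      fun q hq w => by
    have hd := ((hRsub hq).1.differentiableAt (by simp)).hasFDerivAt
    have : HasFDerivAt Ψ _ q := (hd.comp q (hi q)).fst
    rw [this.fderiv]; rfl
  -- the derivative of the primitive, in terms of the straightening
  have hFd : ∀ y ∈ R.target, ∀ w, fderiv ℝ (Z ∘ R.symm) y (fderiv ℝ Ψ (R.symm y) w) =
      fderiv ℝ Z (R.symm y) w := fun y hy w => by
    obtain ⟨-, e', he'⟩ := hRs _ (R.map_target hy)
    have hs := R.hasFDerivAt_symm hy (by rw [hRΨ]; exact he')
    have hZ' := ((hZc _ (R.map_target hy)).differentiableAt (by simp)).hasFDerivAt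
    rw [(hZ'.comp y hs).fderiv, he'.fderiv]
    simp
  refine ⟨Z ∘ R.symm, ?_, ?_, ?_⟩
  · filter_upwards [R.open_target.mem_nhds hx₀] with y hy
    exact (hZc _ (R.map_target hy)).comp y (hRt y hy)
  · filter_upwards [R.open_target.mem_nhds hx₀, hmp] with y hy hmy v hv
    have hq := R.map_target hy
    have hΨy : (φ (i (R.symm y))).1 = y := by
      have := R.right_inv hy
      rwa [hRΨ] at this
    have h1 : fderiv ℝ φ (i (R.symm y)) (i' (p v, 0)) = (m y (p v), b y (p v)) := by
      have h2 : i' (p v, 0) = (p v, 0) := by simp [i']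
      rw [h2, (hRsub hq).2, hΨy]; rfl
    have h3 : fderiv ℝ Ψ (R.symm y) (p v, 0) = v := by
      rw [hΨd _ hq, h1]; exact hmy.2.2.1 v hv
    have h4 := hFd y hy (p v, 0)
    rw [h3, hZd _ hq, h1, hmy.2.2.2, hmy.2.2.1 v hv] at h4
    simpa using h4
  · ext1 v
    have hs0 : R.symm x₀ = 0 := by rw [← hΨ0, R.left_inv hR0]
    have h1 := hFd x₀ hx₀ (e v)
    rw [hs0, hΨd0.fderiv, hZd 0 hR0, hi0, hφd0, ← hL _ (hmp.self_of_nhds.2.1 _)] at h1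
    simp only [ContinuousLinearEquiv.coe_coe, ContinuousLinearEquiv.symm_apply_apply] at h1
    rw [h1, hm0, ← map_add]
    congr 1
    change e.symm ((e v).1, 0) + e.symm (0, (e v).2) = v
    rw [← map_add]
    simp

end Frobenius

/-! ### Smooth frames conjugating Θ to a constant endomorphism. -/

section MovingFrame

universe u

variable {X A B V : Type u} [NormedAddCommGroup X] [NormedSpace ℝ X]
  [NormedAddCommGroup A] [NormedSpace ℝ A] [FiniteDimensional ℝ A]
  [NormedAddCommGroup B] [NormedSpace ℝ B] [FiniteDimensional ℝ B]
  [NormedAddCommGroup V] [NormedSpace ℝ V] [FiniteDimensional ℝ V]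

/-- Complementary subspaces of a finite dimensional space give a continuous splitting. -/
lemma exists_continuous_splitting {D C : Submodule ℝ A} (h : IsCompl D C) :
    ∃ (p : A →L[ℝ] D) (q : A →L[ℝ] C) (e : A ≃L[ℝ] D × C), (∀ v, e v = (p v, q v)) ∧
      (∀ v : D, p v = v) ∧ (∀ v, q v = 0 ↔ v ∈ D) := by
  let e : A ≃L[ℝ] D × C := (Submodule.prodEquivOfIsCompl D C h).symm.toContinuousLinearEquiv
  refine ⟨(ContinuousLinearMap.fst ℝ D C).comp (e : A →L[ℝ] D × C),
    (ContinuousLinearMap.snd ℝ D C).comp (e : A →L[ℝ] D × C), e,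
    fun v => rfl, fun v => ?_, fun v => ?_⟩
  · change ((Submodule.prodEquivOfIsCompl D C h).symm (v : A)).1 = v
    simp
  · change ((Submodule.prodEquivOfIsCompl D C h).symm v).2 = 0 ↔ v ∈ D
    simp

/-- Vectors of the kernel of a family of operators of constant rank extend smoothly. -/
lemma exists_smooth_kernel_section {S : X → A →L[ℝ] B} {x₀ : X}
    (hS : ∀ᶠ x in 𝓝 x₀, ContDiffAt ℝ ∞ S x)
    (hrank : ∀ᶠ x in 𝓝 x₀, Module.finrank ℝ (S x).ker = Module.finrank ℝ (S x₀).ker)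
    {a₀ : A} (ha₀ : S x₀ a₀ = 0) :
    ∃ a : X → A, (∀ᶠ x in 𝓝 x₀, ContDiffAt ℝ ∞ a x) ∧ a x₀ = a₀ ∧ ∀ᶠ x in 𝓝 x₀, S x (a x) = 0 := by
  obtain ⟨N, hN⟩ := Submodule.exists_isCompl (S x₀).ker
  obtain ⟨R', hR'⟩ := Submodule.exists_isCompl (S x₀).range
  obtain ⟨p, q, -, -, hp, -⟩ := exists_continuous_splitting hN
  obtain ⟨P, -, -, -, hP, -⟩ := exists_continuous_splitting hR'
  -- Projecting to the range of `S x₀` makes the operator surjective at x₀, so that the kernel frame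
  -- exists. It can only enlarge the kernels, and constancy of rank shows that it does not.
  let η : X → A →L[ℝ] (S x₀).range := fun x => P.comp (S x)
  have hη₀ : ∀ v, (η x₀ v : B) = S x₀ v := fun v =>
    congrArg Subtype.val (hP ⟨S x₀ v, v, rfl⟩)
  let e₀ : A →ₗ[ℝ] (S x₀).ker × (S x₀).range := (p.prod (η x₀)).toLinearMap
  have hinj : Function.Injective e₀ := by
    rw [← LinearMap.ker_eq_bot, LinearMap.ker_eq_bot']
    intro v hv
    have h1 : p v = 0 := congrArg Prod.fst hv
    have h2 : η x₀ v = 0 := congrArg Prod.snd hv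
    have h3 : S x₀ v = 0 := by rw [← hη₀, h2]; rfl
    have h4 := hp ⟨v, h3⟩
    rw [h1] at h4
    exact (congrArg Subtype.val h4).symm
  have hdim : Module.finrank ℝ A = Module.finrank ℝ ((S x₀).ker × (S x₀).range) := by
    rw [Module.finrank_prod, add_comm]
    exact ((S x₀).toLinearMap.finrank_range_add_finrank_ker).symm
  let e : A ≃L[ℝ] (S x₀).ker × (S x₀).range :=
    (LinearEquiv.ofInjectiveOfFinrankEq e₀ hinj hdim).toContinuousLinearEquiv
  obtain ⟨m, hm, hmp⟩ := exists_kernel_frame (η := η) (p := p)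
    (hS.mono fun x hx => contDiffAt_const.clm_comp hx) e (fun v => rfl)
  refine ⟨fun x => m x ⟨a₀, ha₀⟩, hm.mono fun x hx => hx.clm_apply contDiffAt_const, ?_, ?_⟩
  · have := hmp.self_of_nhds.2.2 a₀ (Subtype.ext ((hη₀ a₀).trans ha₀))
    rwa [hp ⟨a₀, ha₀⟩] at this
  · filter_upwards [hmp, hrank] with x ⟨h1, h2, h3⟩ hr
    have hle : (S x).ker ≤ (η x).ker := fun v hv => by
      have : S x v = 0 := hv
      change P (S x v) = 0
      rw [this, map_zero]
    have heq : (S x).ker = (η x).ker := by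
      refine Submodule.eq_of_le_of_finrank_eq hle ?_
      rw [hr]
      let f : (S x₀).ker →ₗ[ℝ] (η x).ker :=
        LinearMap.codRestrict _ (m x).toLinearMap (fun h => h2 h)
      refine (LinearEquiv.ofBijective f ⟨fun h h' hh => ?_, fun v => ⟨p v, ?_⟩⟩).finrank_eq
      · rw [← h1 h, ← h1 h']
        exact congrArg p (congrArg Subtype.val hh)
      · exact Subtype.ext (h3 v v.2)
    have : m x ⟨a₀, ha₀⟩ ∈ (S x).ker := heq ▸ h2 _
    exact this

/-- A family of mutually conjugate endomorphisms is conjugate to a constant one by a smooth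
moving frame. -/
theorem exists_moving_frame {Θ : V → V →L[ℝ] V} {x₀ : V}
    (hΘ : ∀ᶠ x in 𝓝 x₀, ContDiffAt ℝ ∞ Θ x)
    (hconj : ∀ᶠ x in 𝓝 x₀, ∃ L : V ≃ₗ[ℝ] V, ∀ v, L (Θ x v) = Θ x₀ (L v)) :
    ∃ g : V → V →L[ℝ] V, (∀ᶠ x in 𝓝 x₀, ContDiffAt ℝ ∞ g x) ∧
      g x₀ = ContinuousLinearMap.id ℝ V ∧ ∀ᶠ x in 𝓝 x₀, ∀ v, Θ x (g x v) = g x (Θ x₀ v) := by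
  -- Ker `S x` consists of the intertwiners from Θ(x₀) to Θ(x). Composition with a conjugating `L`
  -- maps it onto Ker `S x₀`, so its dimension is constant and the identity extends to a smooth
  -- section.
  let S : V → (V →L[ℝ] V) →L[ℝ] (V →L[ℝ] V) := fun x =>
    ContinuousLinearMap.compL ℝ V V V (Θ x) - (ContinuousLinearMap.compL ℝ V V V).flip (Θ x₀)
  have hSa : ∀ x g v, S x g v = Θ x (g v) - g (Θ x₀ v) := fun x g v => rfl
  obtain ⟨g, h1, h2, h3⟩ := exists_smooth_kernel_section (S := S) (x₀ := x₀)
    (a₀ := ContinuousLinearMap.id ℝ V)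
    (hΘ.mono fun x hx => (contDiffAt_const.clm_apply hx).sub contDiffAt_const) (by
      filter_upwards [hconj] with x ⟨L, hL⟩
      let Lc := L.toContinuousLinearEquiv
      have hL' : ∀ v, Lc (Θ x v) = Θ x₀ (Lc v) := hL
      let f : (V →L[ℝ] V) ≃ₗ[ℝ] (V →L[ℝ] V) :=
        { toFun := fun g => (Lc : V →L[ℝ] V).comp g
          invFun := fun g => (Lc.symm : V →L[ℝ] V).comp g
          map_add' := fun g g' => by ext; simp
          map_smul' := fun c g => by ext; simp
          left_inv := fun g => by ext; simp
          right_inv := fun g => by ext; simp }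
      have hf : ∀ g, f (S x g) = S x₀ (f g) := fun g => by
        ext v
        change Lc (Θ x (g v) - g (Θ x₀ v)) = Θ x₀ (Lc (g v)) - Lc (g (Θ x₀ v))
        rw [map_sub, hL']
      have hmap : (S x).ker.map (f : (V →L[ℝ] V) →ₗ[ℝ] (V →L[ℝ] V)) = (S x₀).ker := by
        ext g
        constructor
        · rintro ⟨g', hg', rfl⟩
          change S x₀ (f g') = 0
          rw [← hf, show S x g' = 0 from hg', map_zero]
        · intro hg
          refine ⟨f.symm g, ?_, f.apply_symm_apply g⟩
          change S x (f.symm g) = 0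
          apply f.injective
          rw [hf, f.apply_symm_apply, map_zero]
          exact hg
      rw [← hmap, LinearEquiv.finrank_map_eq]) (by ext v; simp [hSa])
  refine ⟨g, h1, h2, h3.mono fun x hx v => ?_⟩
  rw [← sub_eq_zero, ← hSa, hx]; rfl

end MovingFrame

/-! ### Consequences of N = 0 and of involutive kernels for brackets. -/

section Bracket

universe u

variable {V W : Type u} [NormedAddCommGroup V] [NormedSpace ℝ V]
  [NormedAddCommGroup W] [NormedSpace ℝ W]

/-- The Lie derivative of a field of endomorphisms of a normed space. -/
def lieDerivEnd (Θ : V → V →L[ℝ] V) (w : V → V) (x v : V) : V :=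
  fderiv ℝ Θ x (w x) v - fderiv ℝ w x (Θ x v) + Θ x (fderiv ℝ w x v)

/-- Vanishing of the Nijenhuis tensor on constant vector fields, at a point of a normed space. -/
def NijenhuisVanishesAt (Θ : V → V →L[ℝ] V) (x : V) : Prop :=
  ∀ v w, fderiv ℝ Θ x (Θ x v) w - fderiv ℝ Θ x (Θ x w) v =
    Θ x (fderiv ℝ Θ x v w - fderiv ℝ Θ x w v)

/-- Brackets of sections of `Ker Θ^k` near `x` are in `Ker Θ^k` at `x`. -/
def KerPowInvolutiveAt (Θ : V → V →L[ℝ] V) (k : ℕ) (x : V) : Prop :=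
  ∀ X Y : V → V, (∀ᶠ z in 𝓝 x, ContDiffAt ℝ ∞ X z) → (∀ᶠ z in 𝓝 x, ContDiffAt ℝ ∞ Y z) →
    (∀ᶠ z in 𝓝 x, (Θ z ^ k) (X z) = 0) → (∀ᶠ z in 𝓝 x, (Θ z ^ k) (Y z) = 0) →
    (Θ x ^ k) (fderiv ℝ Y x (X x) - fderiv ℝ X x (Y x)) = 0

/-- N = 0 in the form L_{Θw} Θ = Θ ∘ L_w Θ. The derivatives of `w` cancel, leaving the identity for
the constant vectors `w x` and `v`. -/
lemma lieDerivEnd_apply_field {Θ : V → V →L[ℝ] V} {w : V → V} {x : V}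
    (hΘ : DifferentiableAt ℝ Θ x) (hw : DifferentiableAt ℝ w x) (hN : NijenhuisVanishesAt Θ x)
    (v : V) : lieDerivEnd Θ (fun z => Θ z (w z)) x v = Θ x (lieDerivEnd Θ w x v) := by
  have h1 : ∀ u, fderiv ℝ (fun z => Θ z (w z)) x u =
      fderiv ℝ Θ x u (w x) + Θ x (fderiv ℝ w x u) := fun u => by
    rw [(hΘ.hasFDerivAt.clm_apply hw.hasFDerivAt).fderiv]; simp [add_comm]
  have h2 := hN (w x) v
  simp only [lieDerivEnd, h1, map_add, map_sub] at h2 ⊢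
  rw [sub_eq_iff_eq_add] at h2
  rw [h2]
  abel

lemma contDiffAt_pow_apply {Θ : V → V →L[ℝ] V} {w : V → V} {x : V}
    (hΘ : ContDiffAt ℝ ∞ Θ x) (hw : ContDiffAt ℝ ∞ w x) (j : ℕ) :
    ContDiffAt ℝ ∞ (fun z => (Θ z ^ j) (w z)) x := by
  induction j with
  | zero => simpa using hw
  | succ j ih =>
    simp only [pow_succ', mul_apply_eq_comp]
    exact hΘ.clm_apply ih

lemma lieDerivEnd_pow_apply_field {Θ : V → V →L[ℝ] V} {w : V → V} {x : V}
    (hΘ : ContDiffAt ℝ ∞ Θ x) (hw : ContDiffAt ℝ ∞ w x) (hN : NijenhuisVanishesAt Θ x)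
    (j : ℕ) (v : V) :
    lieDerivEnd Θ (fun z => (Θ z ^ j) (w z)) x v = (Θ x ^ j) (lieDerivEnd Θ w x v) := by
  induction j with
  | zero => simp
  | succ j ih =>
    simp only [pow_succ', mul_apply_eq_comp]
    rw [lieDerivEnd_apply_field (hΘ.differentiableAt (by simp))
      ((contDiffAt_pow_apply hΘ hw j).differentiableAt (by simp)) hN, ih]

/-- Θ^k w vanishes near x, hence so does the Lie derivative of Θ along it, and Θ^k can be pulled out
of that derivative. Thus bracketing with a section of Ker Θ^k commutes with Θ modulo Ker Θ^k. -/
lemma pow_lieDerivEnd_eq_zero {Θ : V → V →L[ℝ] V} {w : V → V} {x : V} {k : ℕ}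
    (hΘ : ContDiffAt ℝ ∞ Θ x) (hw : ContDiffAt ℝ ∞ w x) (hN : NijenhuisVanishesAt Θ x)
    (hk : ∀ᶠ z in 𝓝 x, (Θ z ^ k) (w z) = 0) (v : V) :
    (Θ x ^ k) (lieDerivEnd Θ w x v) = 0 := by
  rw [← lieDerivEnd_pow_apply_field hΘ hw hN]
  have h : (fun z => (Θ z ^ k) (w z)) =ᶠ[𝓝 x] fun _ => 0 := hk
  simp only [lieDerivEnd, h.fderiv_eq, hk.self_of_nhds, fderiv_const_apply, map_zero, zero_apply,
    sub_zero, add_zero]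

lemma pow_apply_frame {T g A : V →L[ℝ] V} (h : ∀ v, T (g v) = g (A v)) (j : ℕ) (v : V) :
    (T ^ j) (g v) = g ((A ^ j) v) := by
  induction j with
  | zero => simp
  | succ j ih => rw [pow_succ', pow_succ', mul_apply_eq_comp, ih, h]; rfl

/-- The bracket of two sections `Θ v + g b`, `Θ v' + g b'` of `Im Θ + Ker Θ^k`. -/
lemma bracket_image_add_ker {Θ g : V → V →L[ℝ] V} {A : V →L[ℝ] V} {x : V} {k : ℕ}
    (hΘ : ContDiffAt ℝ ∞ Θ x) (hg : ∀ᶠ z in 𝓝 x, ContDiffAt ℝ ∞ g z)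
    (hint : ∀ᶠ z in 𝓝 x, ∀ v, Θ z (g z v) = g z (A v))
    (hN : NijenhuisVanishesAt Θ x) (hinv : KerPowInvolutiveAt Θ k x) (v v' : V)
    {b b' : V} (hb : (A ^ k) b = 0) (hb' : (A ^ k) b' = 0) :
    (Θ x ^ k) ((fderiv ℝ Θ x (Θ x v + g x b) v' + fderiv ℝ g x (Θ x v + g x b) b') -
      (fderiv ℝ Θ x (Θ x v' + g x b') v + fderiv ℝ g x (Θ x v' + g x b') b) -
      Θ x (fderiv ℝ Θ x v v' - fderiv ℝ Θ x v' v + fderiv ℝ g x v b' - fderiv ℝ g x v' b)) = 0 := by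
  have hgd : DifferentiableAt ℝ g x := hg.self_of_nhds.differentiableAt (by simp)
  have hG : ∀ c, ∀ᶠ z in 𝓝 x, ContDiffAt ℝ ∞ (fun z => g z c) z := fun c =>
    hg.mono fun z hz => hz.clm_apply contDiffAt_const
  have hGd : ∀ c u, fderiv ℝ (fun z => g z c) x u = fderiv ℝ g x u c := fun c u => by
    rw [(hgd.hasFDerivAt.clm_apply (hasFDerivAt_const c x)).fderiv]; simp
  have hGk : ∀ c, (A ^ k) c = 0 → ∀ᶠ z in 𝓝 x, (Θ z ^ k) (g z c) = 0 := fun c hc => by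
    filter_upwards [hint] with z hz
    rw [pow_apply_frame hz, hc, map_zero]
  have h1 := hinv _ _ (hG b) (hG b') (hGk b hb) (hGk b' hb')
  have h2 := pow_lieDerivEnd_eq_zero hΘ (hG b).self_of_nhds hN (hGk b hb) v'
  have h3 := pow_lieDerivEnd_eq_zero hΘ (hG b').self_of_nhds hN (hGk b' hb') v
  have h4 := hN v v'
  simp only [lieDerivEnd, hGd] at h1 h2 h3
  -- Four groups of terms: the bracket of the two kernel sections, two Lie derivatives of Θ along
  -- kernel sections, and the Nijenhuis expression for `v`, `v'`. Θ^k kills the first three, and the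
  -- fourth is zero.
  have h5 : (fderiv ℝ Θ x (Θ x v + g x b) v' + fderiv ℝ g x (Θ x v + g x b) b') -
      (fderiv ℝ Θ x (Θ x v' + g x b') v + fderiv ℝ g x (Θ x v' + g x b') b) -
      Θ x (fderiv ℝ Θ x v v' - fderiv ℝ Θ x v' v + fderiv ℝ g x v b' - fderiv ℝ g x v' b) =
      (fderiv ℝ g x (g x b) b' - fderiv ℝ g x (g x b') b) +
      (fderiv ℝ Θ x (g x b) v' - fderiv ℝ g x (Θ x v') b + Θ x (fderiv ℝ g x v' b)) -
      (fderiv ℝ Θ x (g x b') v - fderiv ℝ g x (Θ x v) b' + Θ x (fderiv ℝ g x v b')) +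
      ((fderiv ℝ Θ x (Θ x v) v' - fderiv ℝ Θ x (Θ x v') v) -
        Θ x (fderiv ℝ Θ x v v' - fderiv ℝ Θ x v' v)) := by
    simp only [map_add, map_sub, add_apply]
    abel
  rw [h5, h4, sub_self, add_zero, map_sub, map_add, h1, h2, h3]
  simp

end Bracket

/-! ### The inductive construction of coordinates making Θ constant. -/

section NormalForm

lemma minSmoothness_two_le_infty : minSmoothness ℝ 2 ≤ ∞ := by
  rw [minSmoothness_of_isRCLikeNormedField]
  exact WithTop.coe_le_coe.2 (le_top : (2 : ℕ∞) ≤ ⊤)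

universe u

variable {V : Type u} [NormedAddCommGroup V] [NormedSpace ℝ V] [FiniteDimensional ℝ V]

/-- Inverting a smooth field of endomorphisms near a point where it is the identity. -/
lemma eventually_inverse_frame {g : V → V →L[ℝ] V} {x₀ : V}
    (hg : ∀ᶠ x in 𝓝 x₀, ContDiffAt ℝ ∞ g x) (hg₀ : g x₀ = ContinuousLinearMap.id ℝ V) :
    ∀ᶠ x in 𝓝 x₀, ContDiffAt ℝ ∞ (fun x => (g x).inverse) x ∧
      (∀ v, g x ((g x).inverse v) = v) ∧ ∀ v, (g x).inverse (g x v) = v := by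
  have : CompleteSpace V := FiniteDimensional.complete ℝ V
  have h1 : ∀ᶠ x in 𝓝 x₀, g x ∈ Set.range ((↑) : (V ≃L[ℝ] V) → V →L[ℝ] V) := by
    apply hg.self_of_nhds.continuousAt.eventually_mem
    rw [hg₀]
    exact ContinuousLinearEquiv.nhds (ContinuousLinearEquiv.refl ℝ V)
  filter_upwards [h1, hg] with x ⟨e', he'⟩ hx
  refine ⟨?_, fun v => ?_, fun v => ?_⟩
  · have := contDiffAt_map_inverse (n := ∞) e'
    rw [he'] at this
    exact this.comp x hx
  all_goals simp [← he']

/-- A linear decomposition of the elements of `Im A + Ker A^k`. -/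
lemma exists_image_ker_decomposition (A : V →L[ℝ] V) (k : ℕ) :
    ∃ σ : V →L[ℝ] V, ∀ d ∈ A.range ⊔ (A ^ k).ker, (A ^ k) (d - A (σ d)) = 0 := by
  set D := A.range ⊔ (A ^ k).ker with hD
  let f : V × (A ^ k).ker →ₗ[ℝ] D := LinearMap.codRestrict D
    (A.toLinearMap.coprod (A ^ k).ker.subtype) (fun q =>
      D.add_mem (Submodule.mem_sup_left ⟨q.1, rfl⟩) (Submodule.mem_sup_right q.2.2))
  have hf : LinearMap.range f = ⊤ := by
    rw [LinearMap.range_eq_top]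
    rintro ⟨d, hd⟩
    obtain ⟨_, ⟨v, rfl⟩, w, hw, rfl⟩ := Submodule.mem_sup.1 hd
    exact ⟨(v, ⟨w, hw⟩), rfl⟩
  obtain ⟨s, hs⟩ := f.exists_rightInverse_of_surjective hf
  obtain ⟨N, hN⟩ := Submodule.exists_isCompl D
  obtain ⟨p, -, -, -, hp, -⟩ := exists_continuous_splitting hN
  refine ⟨((LinearMap.fst ℝ V _ ∘ₗ s).toContinuousLinearMap).comp p, fun d hd => ?_⟩
  have h1 : A (s ⟨d, hd⟩).1 + (s ⟨d, hd⟩).2 = d :=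
    congrArg Subtype.val (LinearMap.congr_fun hs ⟨d, hd⟩)
  have h2 : (A ^ k) (s ⟨d, hd⟩).2 = 0 := (s ⟨d, hd⟩).2.2
  change (A ^ k) (d - A (s (p d)).1) = 0
  rw [hp ⟨d, hd⟩]
  rwa [← eq_sub_iff_add_eq'.2 h1]

/-- A right inverse of `A^k` on `Ker A ∩ Im A^k`. -/
lemma exists_pow_lift (A : V →L[ℝ] V) (k : ℕ) :
    ∃ ρ : V →L[ℝ] V, (∀ v, A v = 0 → v ∈ (A ^ k).range → (A ^ k) (ρ v) = v) ∧
      ∀ v, (A ^ (k + 1)) (ρ v) = 0 := by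
  set S := A.ker ⊓ (A ^ k).range with hS
  let T := S.comap (A ^ k).toLinearMap
  let f : T →ₗ[ℝ] S := ((A ^ k).toLinearMap).restrict (fun v hv => hv)
  have hf : LinearMap.range f = ⊤ := by
    rw [LinearMap.range_eq_top]
    rintro ⟨d, hd⟩
    obtain ⟨v, rfl⟩ := hd.2
    exact ⟨⟨v, hd⟩, rfl⟩
  obtain ⟨s, hs⟩ := f.exists_rightInverse_of_surjective hf
  obtain ⟨N, hN⟩ := Submodule.exists_isCompl S
  obtain ⟨p, -, -, -, hp, -⟩ := exists_continuous_splitting hN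
  have key : ∀ d : S, (A ^ k) (s d) = d := fun d =>
    congrArg Subtype.val (LinearMap.congr_fun hs d)
  refine ⟨((T.subtype ∘ₗ s).toContinuousLinearMap).comp p, fun v h1 h2 => ?_, fun v => ?_⟩
  · change (A ^ k) (s (p v)) = v
    rw [key, hp ⟨v, h1, h2⟩]
  · change (A ^ (k + 1)) (s (p v)) = 0
    rw [pow_succ', mul_apply_eq_comp, key]
    exact (p v).2.1

/-- `F` conjugates `Θ` to `A` after applying `A^k`, and `A^k ∘ F` is a first integral of
`Ker Θ^k`. -/
structure IsPartialNormalForm (Θ : V → V →L[ℝ] V) (x₀ : V) (k : ℕ) (F : V → V) : Prop where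
  smooth : ∀ᶠ x in 𝓝 x₀, ContDiffAt ℝ ∞ F x
  fderiv_base : fderiv ℝ F x₀ = ContinuousLinearMap.id ℝ V
  conj : ∀ᶠ x in 𝓝 x₀, ∀ v,
    (Θ x₀ ^ k) (fderiv ℝ F x (Θ x v)) = (Θ x₀ ^ (k + 1)) (fderiv ℝ F x v)
  ker : ∀ᶠ x in 𝓝 x₀, ∀ w, (Θ x ^ k) w = 0 → (Θ x₀ ^ k) (fderiv ℝ F x w) = 0

omit [FiniteDimensional ℝ V] in
/-- Closedness along `Im Θ + Ker Θ^k` of the form `Θ v + g b ↦ dy(v)`. -/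
lemma hessian_identity {Θ g : V → V →L[ℝ] V} {A : V →L[ℝ] V} {y : V → V} {x : V} {k : ℕ}
    (hΘ : ContDiffAt ℝ ∞ Θ x) (hg : ContDiffAt ℝ ∞ g x) (hy : ContDiffAt ℝ ∞ y x)
    (hint : ∀ᶠ z in 𝓝 x, ∀ v, Θ z (g z v) = g z (A v))
    (hconj : ∀ᶠ z in 𝓝 x, ∀ v, fderiv ℝ y z (Θ z v) = A (fderiv ℝ y z v))
    (hker : ∀ᶠ z in 𝓝 x, ∀ w, (Θ z ^ (k + 1)) w = 0 → fderiv ℝ y z w = 0)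
    (v v' : V) {b b' : V} (hb : (A ^ k) b = 0) (hb' : (A ^ k) b' = 0) :
    fderiv ℝ (fderiv ℝ y) x (Θ x v + g x b) v' - fderiv ℝ (fderiv ℝ y) x (Θ x v' + g x b') v =
      fderiv ℝ y x (fderiv ℝ Θ x v v' - fderiv ℝ Θ x v' v +
        fderiv ℝ g x v b' - fderiv ℝ g x v' b) := by
  have hyd : DifferentiableAt ℝ (fderiv ℝ y) x :=
    (hy.fderiv_right (m := ∞) (by simp)).differentiableAt (by simp)
  have hΘd : DifferentiableAt ℝ Θ x := hΘ.differentiableAt (by simp)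
  have hgd : DifferentiableAt ℝ g x := hg.differentiableAt (by simp)
  have hsymm : ∀ u u', fderiv ℝ (fderiv ℝ y) x u u' = fderiv ℝ (fderiv ℝ y) x u' u :=
    fun u u' => (hy.isSymmSndFDerivAt minSmoothness_two_le_infty).eq u u'
  have h1 : ∀ a c, fderiv ℝ (fderiv ℝ y) x a (Θ x c) + fderiv ℝ y x (fderiv ℝ Θ x a c) =
      A (fderiv ℝ (fderiv ℝ y) x a c) := fun a c => by
    rw [← fderiv_clm_comp_apply hyd hΘd]
    have : (fun z => fderiv ℝ y z (Θ z c)) =ᶠ[𝓝 x] fun z => A (fderiv ℝ y z c) :=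
      hconj.mono fun z hz => hz c
    have h2 : HasFDerivAt (fun z => A (fderiv ℝ y z c)) _ x := A.hasFDerivAt.comp x
      (hyd.hasFDerivAt.clm_apply (hasFDerivAt_const c x))
    rw [this.fderiv_eq, h2.fderiv]
    simp
  have h2 : ∀ a c, (A ^ k) c = 0 → fderiv ℝ (fderiv ℝ y) x a (g x c) +
      fderiv ℝ y x (fderiv ℝ g x a c) = 0 := fun a c hc => by
    rw [← fderiv_clm_comp_apply hyd hgd]
    have : (fun z => fderiv ℝ y z (g z c)) =ᶠ[𝓝 x] fun z => 0 := by
      filter_upwards [hker, hint] with z hz hz'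
      apply hz
      rw [pow_apply_frame hz', pow_succ', mul_apply_eq_comp, hc, map_zero, map_zero]
    rw [this.fderiv_eq, fderiv_const_apply]; rfl
  have e1 := h1 v' v
  have e2 := h1 v v'
  have e3 := h2 v' b hb
  have e4 := h2 v b' hb'
  rw [hsymm v' v] at e1
  rw [hsymm _ v', hsymm _ v]
  simp only [map_add, map_sub]
  rw [← eq_sub_iff_add_eq] at e1 e2
  rw [e1, e2, eq_neg_of_add_eq_zero_left e3, eq_neg_of_add_eq_zero_left e4]
  abel

/-- With y = A^(k+1) F, the new map must satisfy A^k dF'(Θv + w) = dy(v) for w in Ker Θ^k. The right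
side is a form β on Im Θ + Ker Θ^k, closed along it. The defect α = β - A^k dF has values in Ker A ∩
Im A^k there, so a primitive γ of α can be corrected for by F' = F + ργ. Since A^(k+1) ρ = 0, the
correction does not change A^(k+1) dF. -/
theorem IsPartialNormalForm.exists_pred {Θ : V → V →L[ℝ] V} {x₀ : V} {k : ℕ} {F : V → V}
    (hF : IsPartialNormalForm Θ x₀ (k + 1) F)
    (hΘ : ∀ᶠ x in 𝓝 x₀, ContDiffAt ℝ ∞ Θ x)
    (hconj : ∀ᶠ x in 𝓝 x₀, ∃ L : V ≃ₗ[ℝ] V, ∀ v, L (Θ x v) = Θ x₀ (L v))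
    (hN : ∀ᶠ x in 𝓝 x₀, NijenhuisVanishesAt Θ x)
    (hinv : ∀ᶠ x in 𝓝 x₀, KerPowInvolutiveAt Θ k x) :
    ∃ F', IsPartialNormalForm Θ x₀ k F' := by
  have : CompleteSpace V := FiniteDimensional.complete ℝ V
  set A := Θ x₀ with hA
  obtain ⟨g, hg, hg₀, hint⟩ := exists_moving_frame hΘ hconj
  obtain ⟨σ, hσ⟩ := exists_image_ker_decomposition A k
  obtain ⟨ρ, hρ, hρ'⟩ := exists_pow_lift A k
  obtain ⟨N, hDN⟩ := Submodule.exists_isCompl (A.range ⊔ (A ^ k).ker)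
  obtain ⟨p, q, e, he, -, hq⟩ := exists_continuous_splitting hDN
  let y : V → V := fun x => (A ^ (k + 1)) (F x)
  have hyc : ∀ᶠ x in 𝓝 x₀, ContDiffAt ℝ ∞ y x :=
    hF.smooth.mono fun x hx => (A ^ (k + 1)).contDiff.contDiffAt.comp x hx
  have hyd : ∀ᶠ x in 𝓝 x₀, ∀ v, fderiv ℝ y x v = (A ^ (k + 1)) (fderiv ℝ F x v) :=
    hF.smooth.mono fun x hx v => by
      have := (A ^ (k + 1)).hasFDerivAt.comp x (hx.differentiableAt (by simp)).hasFDerivAt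
      rw [show y = (A ^ (k + 1)) ∘ F from rfl, this.fderiv]; rfl
  have hyconj : ∀ᶠ x in 𝓝 x₀, ∀ v, fderiv ℝ y x (Θ x v) = A (fderiv ℝ y x v) := by
    filter_upwards [hyd, hF.conj] with x h1 h2 v
    rw [h1, h1, h2, pow_succ' A (k + 1), mul_apply_eq_comp]
  have hyker : ∀ᶠ x in 𝓝 x₀, ∀ w, (Θ x ^ (k + 1)) w = 0 → fderiv ℝ y x w = 0 := by
    filter_upwards [hyd, hF.ker] with x h1 h2 w hw
    rw [h1, h2 w hw]
  -- the inverse frame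
  let gi : V → V →L[ℝ] V := fun x => (g x).inverse
  have hginv : ∀ᶠ x in 𝓝 x₀, ContDiffAt ℝ ∞ gi x ∧ (∀ v, g x (gi x v) = v) ∧
      ∀ v, gi x (g x v) = v := eventually_inverse_frame hg hg₀
  have hgi₀ : gi x₀ = ContinuousLinearMap.id ℝ V := by
    simp only [gi, hg₀, ContinuousLinearMap.inverse_id]
  let η : V → V →L[ℝ] N := fun x => q.comp (gi x)
  -- The map g σ g⁻¹ picks smoothly, for an element Θv + w of the distribution, a vector that can
  -- replace v; outside the distribution the values of β are irrelevant.
  let β : V → V →L[ℝ] V := fun x => (fderiv ℝ y x).comp ((g x).comp (σ.comp (gi x)))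
  let α : V → V →L[ℝ] V := fun x => β x - (A ^ k).comp (fderiv ℝ F x)
  have hηc : ∀ᶠ x in 𝓝 x₀, ContDiffAt ℝ ∞ η x :=
    hginv.mono fun x hx => contDiffAt_const.clm_comp hx.1
  have hβc : ∀ᶠ x in 𝓝 x₀, ContDiffAt ℝ ∞ β x := by
    filter_upwards [hyc, hg, hginv] with x h1 h2 h3
    exact (h1.fderiv_right (by simp)).clm_comp (h2.clm_comp (contDiffAt_const.clm_comp h3.1))
  have hαc : ∀ᶠ x in 𝓝 x₀, ContDiffAt ℝ ∞ α x := by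
    filter_upwards [hβc, hF.smooth] with x h1 h2
    exact h1.sub (contDiffAt_const.clm_comp (h2.fderiv_right (by simp)))
  -- the distribution `Im Θ + Ker Θ^k`
  have hηker : ∀ᶠ x in 𝓝 x₀, ∀ u, η x u = 0 →
      ∃ v b, (A ^ k) b = 0 ∧ u = Θ x v + g x b := by
    filter_upwards [hginv, hint] with x h1 h2 u hu
    obtain ⟨_, ⟨a, rfl⟩, b, hb, hab⟩ := Submodule.mem_sup.1 ((hq _).1 hu)
    refine ⟨g x a, b, hb, ?_⟩
    rw [h2, ← map_add, ← h1.2.1 u]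
    exact congrArg (g x) hab.symm
  have hmem : ∀ᶠ x in 𝓝 x₀, ∀ v w, (Θ x ^ k) w = 0 → η x (Θ x v + w) = 0 := by
    filter_upwards [hginv, hint] with x h1 h2 v w hw
    refine (hq _).2 ?_
    rw [map_add]
    refine Submodule.add_mem_sup ⟨gi x v, ?_⟩ ?_
    · change A (gi x v) = gi x (Θ x v)
      rw [← h1.2.1 v, h2, h1.2.2, h1.2.2]
    · change (A ^ k) (gi x w) = 0
      rw [← h1.2.2 ((A ^ k) (gi x w)), ← pow_apply_frame h2, h1.2.1, hw, map_zero]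
  have hβval : ∀ᶠ x in 𝓝 x₀, ∀ v w, (Θ x ^ k) w = 0 → β x (Θ x v + w) = fderiv ℝ y x v := by
    filter_upwards [hmem, hginv, hint, hyker] with x h0 h1 h2 h3 v w hw
    have hd := hσ _ ((hq _).1 (h0 v w hw))
    change fderiv ℝ y x (g x (σ (gi x (Θ x v + w)))) = _
    set d := gi x (Θ x v + w) with hd'
    -- Independence of the choice: two admissible v differ by an element of Ker Θ^(k+1), which dy
    -- kills.
    rw [← sub_eq_zero, ← map_sub]
    apply h3
    rw [pow_succ, mul_apply_eq_comp, map_sub, h2]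
    have h4 : g x (A (σ d)) - Θ x v = w - g x (d - A (σ d)) := by
      rw [map_sub, hd', h1.2.1]; abel
    rw [h4, map_sub, hw, pow_apply_frame h2]
    exact (congrArg (fun c => 0 - g x c) hd).trans (by simp)
  -- differentiating along sections of the distribution
  have hclosed : ∀ᶠ x in 𝓝 x₀, ∀ u u', η x u = 0 → η x u' = 0 →
      fderiv ℝ η x u u' = fderiv ℝ η x u' u ∧ fderiv ℝ β x u u' = fderiv ℝ β x u' u := by
    filter_upwards [hΘ, hg.eventually_nhds, hyc, hηc, hβc, hint.eventually_nhds,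
      hyconj.eventually_nhds, hyker.eventually_nhds, hmem.eventually_nhds, hβval.eventually_nhds, hN, hinv, hηker] with
      x hΘx hgxe hyx hηx hβx hintx hyconjx hykerx hmemx hβvalx hNx hinvx hηkerx u u' hu hu'
    obtain ⟨v, b, hb, rfl⟩ := hηkerx u hu
    obtain ⟨v', b', hb', rfl⟩ := hηkerx u' hu'
    have hgx := hgxe.self_of_nhds
    have hΘd : DifferentiableAt ℝ Θ x := hΘx.differentiableAt (by simp)
    have hgd : DifferentiableAt ℝ g x := hgx.differentiableAt (by simp)
    have hηd : DifferentiableAt ℝ η x := hηx.differentiableAt (by simp)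
    have hβd : DifferentiableAt ℝ β x := hβx.differentiableAt (by simp)
    have hyd' : DifferentiableAt ℝ (fderiv ℝ y) x :=
      (hyx.fderiv_right (m := ∞) (by simp)).differentiableAt (by simp)
    have hgk : ∀ c, (A ^ k) c = 0 → ∀ᶠ z in 𝓝 x, (Θ z ^ k) (g z c) = 0 := fun c hc => by
      filter_upwards [hintx] with z hz
      rw [pow_apply_frame hz, hc, map_zero]
    have hsec : ∀ c d, HasFDerivAt (fun z => Θ z c + g z d)
        ((fderiv ℝ Θ x).flip c + (fderiv ℝ g x).flip d) x := fun c d => by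
      convert! (hΘd.hasFDerivAt.clm_apply (hasFDerivAt_const c x)).add
        (hgd.hasFDerivAt.clm_apply (hasFDerivAt_const d x)) using 1
      simp
    have hη1 : ∀ a c d, (A ^ k) d = 0 → fderiv ℝ η x a (Θ x c + g x d) +
        η x (fderiv ℝ Θ x a c + fderiv ℝ g x a d) = 0 := fun a c d hd => by
      have h0 : (fun z => η z (Θ z c + g z d)) =ᶠ[𝓝 x] fun _ => 0 := by
        filter_upwards [hmemx, hgk d hd] with z hz hz'
        exact hz c _ hz'
      have h1 := (hηd.hasFDerivAt.clm_apply (hsec c d)).fderiv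
      rw [h0.fderiv_eq, fderiv_const_apply] at h1
      have := DFunLike.congr_fun h1 a
      simpa [add_comm, eq_comm] using this
    have hβ1 : ∀ a c d, (A ^ k) d = 0 → fderiv ℝ β x a (Θ x c + g x d) +
        β x (fderiv ℝ Θ x a c + fderiv ℝ g x a d) =
        fderiv ℝ (fderiv ℝ y) x a c := fun a c d hd => by
      have h0 : (fun z => β z (Θ z c + g z d)) =ᶠ[𝓝 x] fun z => fderiv ℝ y z c := by
        filter_upwards [hβvalx, hgk d hd] with z hz hz'
        exact hz c _ hz'
      have h1 := (hβd.hasFDerivAt.clm_apply (hsec c d)).fderiv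
      rw [h0.fderiv_eq, (hyd'.hasFDerivAt.clm_apply (hasFDerivAt_const c x)).fderiv] at h1
      have := DFunLike.congr_fun h1 a
      simpa [add_comm, eq_comm] using this
    have hbr := bracket_image_add_ker hΘx hgxe hintx hNx hinvx v v' hb hb'
    set br := (fderiv ℝ Θ x (Θ x v + g x b) v' + fderiv ℝ g x (Θ x v + g x b) b') -
      (fderiv ℝ Θ x (Θ x v' + g x b') v + fderiv ℝ g x (Θ x v' + g x b') b) with hbr'
    set a := fderiv ℝ Θ x v v' - fderiv ℝ Θ x v' v + fderiv ℝ g x v b' - fderiv ℝ g x v' b with ha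
    have hbra : br = Θ x a + (br - Θ x a) := by abel
    constructor
    · have h1 := hη1 (Θ x v + g x b) v' b' hb'
      have h2 := hη1 (Θ x v' + g x b') v b hb
      have h3 : η x br = 0 := by
        rw [hbra]; exact hmemx.self_of_nhds _ _ hbr
      rw [hbr', map_sub, sub_eq_zero] at h3
      rw [eq_neg_of_add_eq_zero_left h1, eq_neg_of_add_eq_zero_left h2, h3]
    · have h1 := hβ1 (Θ x v + g x b) v' b' hb'
      have h2 := hβ1 (Θ x v' + g x b') v b hb
      -- Differentiating β(Θv + gb) = dy(v) gives dβ(u, u') = H(u)v' - H(u')v - β(br), with H the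
      -- second derivative of y. Both β(br) and the difference of Hessian terms equal dy(a), so
      -- dβ(u, u') = 0.
      have h3 : β x br = fderiv ℝ y x a := by
        rw [hbra]; exact hβvalx.self_of_nhds _ _ hbr
      have h4 := hessian_identity hΘx hgx hyx hintx hyconjx hykerx v v' hb hb'
      rw [hbr', map_sub, ← h4, ← h1, ← h2] at h3
      rw [← sub_eq_zero]
      rw [← sub_eq_zero] at h3
      rw [← neg_eq_zero, ← h3]
      abel
  obtain ⟨γ, hγc, hγd, hγ₀⟩ := exists_primitive_along (p := p) (η := η) (α := α) (x₀ := x₀)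
    hηc hαc e (fun v => by rw [he]; simp [η, hgi₀])
    (hclosed.mono fun x hx u u' hu hu' => (hx u u' hu hu').1)
    (by
      filter_upwards [hclosed, hβc, hF.smooth] with x hx hβx hFx u u' hu hu'
      have hFd : DifferentiableAt ℝ (fderiv ℝ F) x :=
        (hFx.fderiv_right (m := ∞) (by simp)).differentiableAt (by simp)
      have h1 : ∀ a c, fderiv ℝ α x a c =
          fderiv ℝ β x a c - (A ^ k) (fderiv ℝ (fderiv ℝ F) x a c) := fun a c => by
        have h2 : HasFDerivAt α _ x := (hβx.differentiableAt (by simp)).hasFDerivAt.sub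
          ((hasFDerivAt_const (A ^ k) x).clm_comp hFd.hasFDerivAt)
        rw [h2.fderiv]
        simp
      rw [h1, h1, (hx u u' hu hu').2, (hFx.isSymmSndFDerivAt minSmoothness_two_le_infty).eq u u'])
    -- At x₀ both β and A^k dF equal A^k on the distribution, so α vanishes there. Hence dγ(x₀) = 0
    -- may be prescribed, which keeps dF'(x₀) = id.
    0 (fun v hv => by
      have hv' : v ∈ A.range ⊔ (A ^ k).ker := by
        have := (hq _).1 hv
        rwa [hgi₀] at this
      have := hσ v hv'
      simp only [α, β, hgi₀, hg₀, hF.fderiv_base, hyd.self_of_nhds, sub_apply,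
        ContinuousLinearMap.comp_apply, ContinuousLinearMap.id_apply, zero_apply]
      rw [pow_succ, mul_apply_eq_comp, ← map_sub, ← neg_sub, map_neg, this, neg_zero])
  have hF'd : ∀ᶠ x in 𝓝 x₀, ∀ v, fderiv ℝ (fun x => F x + ρ (γ x)) x v =
      fderiv ℝ F x v + ρ (fderiv ℝ γ x v) := by
    filter_upwards [hF.smooth, hγc] with x h1 h2 v
    have := (h1.differentiableAt (by simp)).hasFDerivAt.add
      (ρ.hasFDerivAt.comp x (h2.differentiableAt (by simp)).hasFDerivAt)
    have h3 : HasFDerivAt (fun x => F x + ρ (γ x)) _ x := this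
    rw [h3.fderiv]; rfl
  have hρα : ∀ᶠ x in 𝓝 x₀, ∀ v w, (Θ x ^ k) w = 0 → (A ^ k) (ρ (fderiv ℝ γ x (Θ x v + w))) =
      (A ^ (k + 1)) (fderiv ℝ F x v) - (A ^ k) (fderiv ℝ F x (Θ x v + w)) := by
    filter_upwards [hγd, hmem, hβval, hyd, hyconj, hyker] with x h1 h2 h3 h4 h5 h6 v w hw
    have h7 : α x (Θ x v + w) =
        (A ^ (k + 1)) (fderiv ℝ F x v) - (A ^ k) (fderiv ℝ F x (Θ x v + w)) := by
      rw [← h4, ← h3 v w hw]; rfl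
    rw [h1 _ (h2 v w hw), ← h7]
    -- It remains that the value lies in Ker A (from A dy = dy Θ and dy(w) = 0) and in Im A^k (both
    -- terms of α do).
    apply hρ
    · have h8 : fderiv ℝ y x w = 0 := h6 w (by rw [pow_succ', mul_apply_eq_comp, hw, map_zero])
      have h9 := h5 v
      rw [h7, map_sub, ← mul_apply_eq_comp A (A ^ k), ← pow_succ', ← h4, ← h4, map_add, h8,
        add_zero, h9, sub_self]
    · rw [h7, pow_succ, mul_apply_eq_comp, ← map_sub]
      exact ⟨_, rfl⟩
  refine ⟨fun x => F x + ρ (γ x), ?_, ?_, ?_, ?_⟩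
  · filter_upwards [hF.smooth, hγc] with x h1 h2
    exact h1.add (ρ.contDiff.contDiffAt.comp x h2)
  · ext1 v
    rw [hF'd.self_of_nhds, hF.fderiv_base, hγ₀]; simp
  · filter_upwards [hF'd, hρα] with x h1 h2 v
    have h3 := h2 v 0 (map_zero _)
    rw [add_zero] at h3
    rw [h1, h1, map_add, map_add, h3, hρ']
    abel
  · filter_upwards [hF'd, hρα] with x h1 h2 w hw
    have h3 := h2 0 w hw
    rw [map_zero, zero_add, map_zero, map_zero, zero_sub] at h3
    rw [h1, map_add, h3, add_neg_cancel]

/-- A smooth field of mutually conjugate nilpotent endomorphisms with vanishing Nijenhuis tensor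
and involutive kernels is locally constant in suitable coordinates. -/
theorem exists_normal_form {Θ : V → V →L[ℝ] V} {x₀ : V}
    (hΘ : ∀ᶠ x in 𝓝 x₀, ContDiffAt ℝ ∞ Θ x)
    (hconj : ∀ᶠ x in 𝓝 x₀, ∃ L : V ≃ₗ[ℝ] V, ∀ v, L (Θ x v) = Θ x₀ (L v))
    (hnil : IsNilpotent (Θ x₀))
    (hN : ∀ᶠ x in 𝓝 x₀, NijenhuisVanishesAt Θ x)
    (hinv : ∀ k, ∀ᶠ x in 𝓝 x₀, KerPowInvolutiveAt Θ k x) :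
    ∃ F : V → V, (∀ᶠ x in 𝓝 x₀, ContDiffAt ℝ ∞ F x) ∧
      fderiv ℝ F x₀ = ContinuousLinearMap.id ℝ V ∧
      ∀ᶠ x in 𝓝 x₀, ∀ v, fderiv ℝ F x (Θ x v) = Θ x₀ (fderiv ℝ F x v) := by
  have hdown : ∀ k F, IsPartialNormalForm Θ x₀ k F → ∃ F', IsPartialNormalForm Θ x₀ 0 F' := by
    intro k
    induction k with
    | zero => exact fun F hF => ⟨F, hF⟩
    | succ k ih =>
      intro F hF
      obtain ⟨F', hF'⟩ := hF.exists_pred hΘ hconj hN (hinv k)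
      exact ih F' hF'
  obtain ⟨k, hk⟩ := hnil
  -- For A^k = 0 the conditions at level k only involve zero maps, so the identity satisfies them.
  obtain ⟨F, hF⟩ := hdown k id ⟨Filter.Eventually.of_forall fun x => contDiffAt_id, fderiv_id,
    Filter.Eventually.of_forall fun x v => by simp [pow_succ', hk],
    Filter.Eventually.of_forall fun x w _ => by simp [hk]⟩
  refine ⟨F, hF.smooth, hF.fderiv_base, hF.conj.mono fun x hx v => ?_⟩
  simpa using hx v

end NormalForm

/-! ### Vector fields, endomorphisms and brackets in a chart. -/

section Charts

lemma mlieBracket_eq_lieBracket {E : Type*} [NormedAddCommGroup E] [NormedSpace ℝ E]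
    {V W : (x : E) → TangentSpace 𝓘(ℝ, E) x} :
    VectorField.mlieBracket 𝓘(ℝ, E) V W = VectorField.lieBracket ℝ V W := by
  rw [← VectorField.mlieBracketWithin_univ, VectorField.mlieBracketWithin_eq_lieBracketWithin]
  exact VectorField.lieBracketWithin_univ

variable {n : ℕ} {M : Type*} [TopologicalSpace M] [ChartedSpace (EuclideanSpace ℝ (Fin n)) M]

/-- The derivative of a chart, as a map into the model space. -/
def chartDeriv (e : OpenPartialHomeomorph M (EuclideanSpace ℝ (Fin n))) (y : M) :
    TangentSpace (𝓡 n) y →L[ℝ] EuclideanSpace ℝ (Fin n) :=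
  mfderiv (𝓡 n) (𝓡 n) e y

/-- The inverse of the derivative of a chart. -/
def chartDerivInv (e : OpenPartialHomeomorph M (EuclideanSpace ℝ (Fin n))) (y : M) :
    EuclideanSpace ℝ (Fin n) →L[ℝ] TangentSpace (𝓡 n) y :=
  (chartDeriv e y).inverse

/-- The coordinate expression of a vector field in a chart. -/
def chartPush (e : OpenPartialHomeomorph M (EuclideanSpace ℝ (Fin n))) (v : VecField n M)
    (z : EuclideanSpace ℝ (Fin n)) : EuclideanSpace ℝ (Fin n) :=
  chartDeriv e (e.symm z) (v (e.symm z))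

/-- The coordinate expression of a field of endomorphisms in a chart. -/
def chartEndo (e : OpenPartialHomeomorph M (EuclideanSpace ℝ (Fin n))) (Θ : EndoField n M)
    (z : EuclideanSpace ℝ (Fin n)) : EuclideanSpace ℝ (Fin n) →L[ℝ] EuclideanSpace ℝ (Fin n) :=
  chartDeriv e (e.symm z) ∘L Θ (e.symm z) ∘L chartDerivInv e (e.symm z)

/-- The vector field on the domain of a chart with given coordinate expression. -/
def chartPull (e : OpenPartialHomeomorph M (EuclideanSpace ℝ (Fin n)))
    (X : EuclideanSpace ℝ (Fin n) → EuclideanSpace ℝ (Fin n)) : VecField n M :=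
  fun y => chartDerivInv e y (X (e y))

lemma chartPush_apply {e : OpenPartialHomeomorph M (EuclideanSpace ℝ (Fin n))} {y : M}
    (hy : y ∈ e.source) (v : VecField n M) :
    chartPush e v (e y) = chartDeriv e y (v y) := by
  rw [chartPush, e.left_inv hy]

variable {e : OpenPartialHomeomorph M (EuclideanSpace ℝ (Fin n))}
  (he : e ∈ IsManifold.maximalAtlas (𝓡 n) ∞ M) {y : M}

include he

lemma mdifferentiable_of_mem_maximalAtlas : e.MDifferentiable (𝓡 n) (𝓡 n) :=
  ⟨(contMDiffOn_of_mem_maximalAtlas he).mdifferentiableOn (by simp),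
    (contMDiffOn_symm_of_mem_maximalAtlas he).mdifferentiableOn (by simp)⟩

lemma isInvertible_chartDeriv (hy : y ∈ e.source) : (chartDeriv e y).IsInvertible :=
  ⟨(mdifferentiable_of_mem_maximalAtlas he).mfderiv hy, rfl⟩

lemma chartDerivInv_chartDeriv (hy : y ∈ e.source) (v : TangentSpace (𝓡 n) y) :
    chartDerivInv e y (chartDeriv e y v) = v := by
  have h := (isInvertible_chartDeriv he hy).inverse_comp_self
  exact congrArg (fun f : TangentSpace (𝓡 n) y →L[ℝ] TangentSpace (𝓡 n) y => f v) h

lemma chartDeriv_chartDerivInv (hy : y ∈ e.source) (u : EuclideanSpace ℝ (Fin n)) :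
    chartDeriv e y (chartDerivInv e y u) = u := by
  have h := (isInvertible_chartDeriv he hy).self_comp_inverse
  exact congrArg (fun f : EuclideanSpace ℝ (Fin n) →L[ℝ] EuclideanSpace ℝ (Fin n) => f u) h

lemma chartDeriv_injective (hy : y ∈ e.source) : Function.Injective (chartDeriv e y) :=
  Function.LeftInverse.injective (chartDerivInv_chartDeriv he hy)

lemma chartEndo_apply (hy : y ∈ e.source) (Θ : EndoField n M) (v : TangentSpace (𝓡 n) y) :
    chartEndo e Θ (e y) (chartDeriv e y v) = chartDeriv e y (Θ y v) := by
  rw [chartEndo, e.left_inv hy]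
  simp [chartDerivInv_chartDeriv he hy]

lemma chartPush_app (Θ : EndoField n M) (v : VecField n M) {z : EuclideanSpace ℝ (Fin n)}
    (hz : z ∈ e.target) : chartPush e (Θ.app v) z = chartEndo e Θ z (chartPush e v z) := by
  have h := chartEndo_apply he (e.map_target hz) Θ (v (e.symm z))
  rw [e.right_inv hz] at h
  exact h.symm

/-- Gives access to the smoothness and bracket naturality results for pullbacks of vector fields. -/
lemma chartPush_eq_mpullback (v : VecField n M) {z : EuclideanSpace ℝ (Fin n)}
    (hz : z ∈ e.target) :
    chartPush e v z = VectorField.mpullback (𝓡 n) (𝓡 n) e.symm v z := by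
  have h1 := (mdifferentiable_of_mem_maximalAtlas he).symm.symm_comp_deriv hz
  have h2 := (mdifferentiable_of_mem_maximalAtlas he).symm.comp_symm_deriv (e.map_target hz)
  have h3 : (mfderiv (𝓡 n) (𝓡 n) e.symm z).inverse = chartDeriv e (e.symm z) := by
    refine ContinuousLinearMap.inverse_eq ?_ ?_
    · rw [e.symm_symm, e.right_inv hz] at h2
      exact h2
    · exact h1
  rw [VectorField.mpullback_apply, h3]
  rfl

lemma isInvertible_mfderiv_symm {z : EuclideanSpace ℝ (Fin n)} (hz : z ∈ e.target) :
    (mfderiv (𝓡 n) (𝓡 n) e.symm z).IsInvertible :=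
  ⟨(mdifferentiable_of_mem_maximalAtlas he).symm.mfderiv hz, rfl⟩

lemma chartDeriv_chartPull (X : EuclideanSpace ℝ (Fin n) → EuclideanSpace ℝ (Fin n))
    (hy : y ∈ e.source) : chartDeriv e y (chartPull e X y) = X (e y) :=
  chartDeriv_chartDerivInv he hy _

lemma chartPush_chartPull (X : EuclideanSpace ℝ (Fin n) → EuclideanSpace ℝ (Fin n))
    {z : EuclideanSpace ℝ (Fin n)} (hz : z ∈ e.target) : chartPush e (chartPull e X) z = X z := by
  rw [chartPush, chartDeriv_chartPull he X (e.map_target hz), e.right_inv hz]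

variable [IsManifold (𝓡 n) ∞ M]

lemma contDiffAt_chartPush {v : VecField n M} (hy : y ∈ e.source)
    (hv : ContMDiffAt (𝓡 n) ((𝓡 n).prod 𝓘(ℝ, EuclideanSpace ℝ (Fin n))) ∞
      (fun x => (⟨x, v x⟩ : Bundle.TotalSpace (EuclideanSpace ℝ (Fin n))
        (TangentSpace (𝓡 n) : M → Type _))) y) :
    ContDiffAt ℝ ∞ (chartPush e v) (e y) := by
  have hz := e.map_source hy
  have h := ContMDiffAt.mpullback_vectorField_preimage (V := v) (f := e.symm) (x₀ := e y)
    (by rw [e.left_inv hy]; exact hv) (contMDiffAt_symm_of_mem_maximalAtlas he hz)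
    (isInvertible_mfderiv_symm he hz) le_rfl
  rw [contMDiffAt_vectorSpace_iff_contDiffAt] at h
  refine h.congr_of_eventuallyEq ?_
  filter_upwards [e.open_target.mem_nhds hz] with z hz using chartPush_eq_mpullback he v hz

lemma chartPush_mlieBracket {v w : VecField n M} (hy : y ∈ e.source)
    (hv : MDifferentiableAt (𝓡 n) ((𝓡 n).prod 𝓘(ℝ, EuclideanSpace ℝ (Fin n)))
      (fun x => (⟨x, v x⟩ : Bundle.TotalSpace (EuclideanSpace ℝ (Fin n))
        (TangentSpace (𝓡 n) : M → Type _))) y)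
    (hw : MDifferentiableAt (𝓡 n) ((𝓡 n).prod 𝓘(ℝ, EuclideanSpace ℝ (Fin n)))
      (fun x => (⟨x, w x⟩ : Bundle.TotalSpace (EuclideanSpace ℝ (Fin n))
        (TangentSpace (𝓡 n) : M → Type _))) y) :
    chartDeriv e y (VectorField.mlieBracket (𝓡 n) v w y) =
      fderiv ℝ (chartPush e w) (e y) (chartPush e v (e y)) -
        fderiv ℝ (chartPush e v) (e y) (chartPush e w (e y)) := by
  have hz := e.map_source hy
  have : IsManifold (𝓡 n) (minSmoothness ℝ 2) M := .of_le minSmoothness_two_le_infty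
  have hev : ∀ v : VecField n M, VectorField.mpullback (𝓡 n) (𝓡 n) e.symm v =ᶠ[𝓝 (e y)]
      chartPush e v := fun v => by
    filter_upwards [e.open_target.mem_nhds hz] with z hz
      using (chartPush_eq_mpullback he v hz).symm
  have h := VectorField.mpullback_mlieBracket (V := v) (W := w) (f := e.symm) (x₀ := e y)
    (by rw [e.left_inv hy]; exact hv) (by rw [e.left_inv hy]; exact hw)
    (contMDiffAt_symm_of_mem_maximalAtlas he hz) minSmoothness_two_le_infty
  rw [← chartPush_apply hy (VectorField.mlieBracket (𝓡 n) v w), chartPush_eq_mpullback he _ hz,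
    h, (hev v).mlieBracket_vectorField_eq (hev w)]
  exact congrFun (mlieBracket_eq_lieBracket (V := chartPush e v) (W := chartPush e w)) (e y)

lemma contMDiffAt_chartPull {X : EuclideanSpace ℝ (Fin n) → EuclideanSpace ℝ (Fin n)}
    (hy : y ∈ e.source) (hX : ContDiffAt ℝ ∞ X (e y)) :
    ContMDiffAt (𝓡 n) ((𝓡 n).prod 𝓘(ℝ, EuclideanSpace ℝ (Fin n))) ∞
      (fun x => (⟨x, chartPull e X x⟩ : Bundle.TotalSpace (EuclideanSpace ℝ (Fin n))
        (TangentSpace (𝓡 n) : M → Type _))) y :=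
  ContMDiffAt.mpullback_vectorField_preimage (f := e) (x₀ := y)
    (contMDiffAt_vectorSpace_iff_contDiffAt.2 hX) (contMDiffAt_of_mem_maximalAtlas he hy)
    (isInvertible_chartDeriv he hy) le_rfl

/-- A smooth germ of a vector field, given in coordinates, extends to a global field supported in
a prescribed neighbourhood. -/
lemma exists_global_extension [T2Space M]
    {X : EuclideanSpace ℝ (Fin n) → EuclideanSpace ℝ (Fin n)}
    (hy : y ∈ e.source) (hX : ∀ᶠ z in 𝓝 (e y), ContDiffAt ℝ ∞ X z) {U : Set M} (hU : U ∈ 𝓝 y) :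
    ∃ v : VecField n M, v.IsSmooth ∧ chartPush e v =ᶠ[𝓝 (e y)] X ∧
      ∀ x, v x = 0 ∨ x ∈ U ∧ x ∈ e.source ∧ ∃ c : ℝ, chartDeriv e x (v x) = c • X (e x) := by
  have h1 : ∀ᶠ x in 𝓝 y, ContDiffAt ℝ ∞ X (e x) := (e.continuousAt hy).eventually hX
  obtain ⟨s, hs, hso, hys⟩ := eventually_nhds_iff.1
    ((h1.and (Filter.eventually_of_mem hU fun x hx => hx)).and
      (e.open_source.eventually_mem hy))
  obtain ⟨f, -, hf⟩ := (SmoothBumpFunction.nhds_basis_tsupport (I := 𝓡 n) y).mem_iff.1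
    (hso.mem_nhds hys)
  -- At every point the extension is zero or a scalar multiple of `X`, so pointwise linear
  -- conditions such as membership in Ker Θ^k, once valid on `U`, hold on all of `M`.
  refine ⟨(f : M → ℝ) • chartPull e X, ?_, ?_, fun x => ?_⟩
  · refine ContMDiffOn.smul_section_of_tsupport (u := s) f.contMDiff.contMDiffOn hso hf
      fun x hx => ?_
    exact (contMDiffAt_chartPull he (hs x hx).2 (hs x hx).1.1).contMDiffWithinAt
  · have h2 : ∀ᶠ z in 𝓝 (e y), f (e.symm z) = 1 := by
      have hc := e.continuousAt_symm (e.map_source hy)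
      rw [ContinuousAt, e.left_inv hy] at hc
      exact hc.eventually f.eventuallyEq_one
    filter_upwards [h2, e.open_target.mem_nhds (e.map_source hy)] with z hz1 hz2
    rw [← chartPush_chartPull he X hz2]
    simp only [chartPush, Pi.smul_apply']
    rw [hz1, one_smul]
  · by_cases hx : x ∈ tsupport f
    · refine Or.inr ⟨(hs x (hf hx)).1.2, (hs x (hf hx)).2, f x, ?_⟩
      simp only [Pi.smul_apply']
      rw [map_smul, chartDeriv_chartPull he X (hs x (hf hx)).2]
    · left
      simp only [Pi.smul_apply']
      rw [image_eq_zero_of_notMem_tsupport hx, zero_smul]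

end Charts

/-! ### From conditions on M to conditions in a chart, and back. -/

section Transfer

variable {n : ℕ} {M : Type*} [TopologicalSpace M] [ChartedSpace (EuclideanSpace ℝ (Fin n)) M]
  {Θ : EndoField n M} {e : OpenPartialHomeomorph M (EuclideanSpace ℝ (Fin n))} {y : M}

/-- Smooth fields with values in `Ker Θ^k` are closed under the Lie bracket. -/
def EndoField.KerInvolutive [IsManifold (𝓡 n) ∞ M] (Θ : EndoField n M) (k : ℕ) : Prop :=
  ∀ v w : VecField n M, v.IsSmooth → w.IsSmooth → (∀ x, (Θ x ^ k) (v x) = 0) →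
    (∀ x, (Θ x ^ k) (w x) = 0) → ∀ x, (Θ x ^ k) (VectorField.mlieBracket (𝓡 n) v w x) = 0

section

variable (he : e ∈ IsManifold.maximalAtlas (𝓡 n) ∞ M)
include he

lemma chartEndo_pow_apply (hy : y ∈ e.source) (Θ : EndoField n M) (k : ℕ)
    (v : TangentSpace (𝓡 n) y) :
    (chartEndo e Θ (e y) ^ k) (chartDeriv e y v) = chartDeriv e y ((Θ y ^ k) v) := by
  induction k generalizing v with
  | zero => rfl
  | succ k ih =>
    rw [pow_succ, pow_succ]
    change (chartEndo e Θ (e y) ^ k) (chartEndo e Θ (e y) (chartDeriv e y v)) =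
      chartDeriv e y ((Θ y ^ k) (Θ y v))
    rw [chartEndo_apply he hy, ih]

lemma chartEndo_eq_of_forall (hy : y ∈ e.source)
    {A : EuclideanSpace ℝ (Fin n) →L[ℝ] EuclideanSpace ℝ (Fin n)}
    (h : ∀ v, chartDeriv e y (Θ y v) = A (chartDeriv e y v)) : chartEndo e Θ (e y) = A := by
  ext1 u
  rw [← chartDeriv_chartDerivInv he hy u, chartEndo_apply he hy, h]

lemma isNilpotent_chartEndo (hy : y ∈ e.source) (h : IsNilpotent (Θ y)) :
    IsNilpotent (chartEndo e Θ (e y)) := by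
  obtain ⟨k, hk⟩ := h
  refine ⟨k, ContinuousLinearMap.ext fun u => ?_⟩
  rw [← chartDeriv_chartDerivInv he hy u, chartEndo_pow_apply he hy, hk]
  simp

lemma chartEndo_conj (hΘ : Θ.AlgebraicallyConstant) {x : M} (hx : x ∈ e.source)
    (hy : y ∈ e.source) :
    ∃ L : EuclideanSpace ℝ (Fin n) ≃ₗ[ℝ] EuclideanSpace ℝ (Fin n),
      ∀ v, L (chartEndo e Θ (e y) v) = chartEndo e Θ (e x) (L v) := by
  obtain ⟨L, hL⟩ := hΘ y x
  obtain ⟨a, ha⟩ := isInvertible_chartDeriv he hx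
  obtain ⟨b, hb⟩ := isInvertible_chartDeriv he hy
  refine ⟨b.symm.toLinearEquiv.trans (L.trans a.toLinearEquiv), fun v => ?_⟩
  obtain ⟨v, rfl⟩ := b.surjective v
  have hb' : ∀ v, b v = chartDeriv e y v := fun v => congrArg (fun f => f v) hb
  have ha' : ∀ v, a v = chartDeriv e x v := fun v => congrArg (fun f => f v) ha
  rw [hb', chartEndo_apply he hy, ← hb', ← hb']
  simp [ha', hL, chartEndo_apply he hx]

end

theorem EndoField.LocallyConstant.isIntegrableDistribution_kerPow (h : Θ.LocallyConstant) (i : ℕ) :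
    IsIntegrableDistribution (Θ.kerPow i) := by
  intro x
  obtain ⟨e, he, hx, A, hA⟩ := h x
  refine ⟨e, he, hx, LinearMap.ker (A ^ i).toLinearMap, fun y hy v => ?_⟩
  have h1 := chartEndo_pow_apply he hy Θ i v
  rw [chartEndo_eq_of_forall he hy (hA y hy)] at h1
  change (Θ y ^ i) v = 0 ↔ (A ^ i) (chartDeriv e y v) = 0
  rw [h1, map_eq_zero_iff _ (chartDeriv_injective he hy)]

variable [IsManifold (𝓡 n) ∞ M]

lemma EndoField.IsSmooth.app (hΘ : Θ.IsSmooth) {v : VecField n M} (hv : v.IsSmooth) :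
    (Θ.app v).IsSmooth := fun x => (hΘ x).clm_bundle_apply (hv x)

lemma VecField.IsSmooth.mdifferentiableAt {v : VecField n M} (hv : v.IsSmooth) (x : M) :
    MDifferentiableAt (𝓡 n) ((𝓡 n).prod 𝓘(ℝ, EuclideanSpace ℝ (Fin n)))
      (fun x => (⟨x, v x⟩ : Bundle.TotalSpace (EuclideanSpace ℝ (Fin n))
        (TangentSpace (𝓡 n) : M → Type _))) x :=
  (hv x).mdifferentiableAt (by simp)

section

variable (he : e ∈ IsManifold.maximalAtlas (𝓡 n) ∞ M)
include he

/-- Smoothness is tested on constant vectors, seen on `M` as smooth local fields to which Θ is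
applied. -/
lemma contDiffAt_chartEndo (hΘ : Θ.IsSmooth) (hy : y ∈ e.source) :
    ContDiffAt ℝ ∞ (chartEndo e Θ) (e y) := by
  have h : ContDiffOn ℝ ∞ (chartEndo e Θ) e.target := by
    rw [contDiffOn_clm_apply]
    intro u z hz
    refine ContDiffAt.contDiffWithinAt ?_
    have hc := contMDiffAt_chartPull he (e.map_target hz)
      (contDiffAt_const (c := u) (x := e (e.symm z)) (n := ∞) (𝕜 := ℝ))
    have := contDiffAt_chartPush he (v := Θ.app (chartPull e fun _ => u)) (e.map_target hz)
      ((hΘ _).clm_bundle_apply hc)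
    rw [e.right_inv hz] at this
    refine this.congr_of_eventuallyEq ?_
    filter_upwards [e.open_target.mem_nhds hz] with z hz
    rw [chartPush_app he Θ _ hz, chartPush_chartPull he _ hz]
  exact h.contDiffAt (e.open_target.mem_nhds (e.map_source hy))

lemma eventually_contDiffAt_chartEndo (hΘ : Θ.IsSmooth) (hy : y ∈ e.source) :
    ∀ᶠ z in 𝓝 (e y), ContDiffAt ℝ ∞ (chartEndo e Θ) z := by
  filter_upwards [e.open_target.mem_nhds (e.map_source hy)] with z hz
  have := contDiffAt_chartEndo he hΘ (e.map_target hz)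
  rwa [e.right_inv hz] at this

/-- Tensoriality of N: all derivatives of `v` and `w` cancel, and only first derivatives of the
coordinate expression of Θ remain. -/
lemma chartDeriv_nijenhuis (hΘ : Θ.IsSmooth) {v w : VecField n M} (hv : v.IsSmooth)
    (hw : w.IsSmooth) (hy : y ∈ e.source) :
    chartDeriv e y (Θ.nijenhuis v w y) =
      chartEndo e Θ (e y) (fderiv ℝ (chartEndo e Θ) (e y) (chartDeriv e y (v y))
          (chartDeriv e y (w y))
        - fderiv ℝ (chartEndo e Θ) (e y) (chartDeriv e y (w y)) (chartDeriv e y (v y)))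
      - (fderiv ℝ (chartEndo e Θ) (e y) (chartEndo e Θ (e y) (chartDeriv e y (v y)))
          (chartDeriv e y (w y))
        - fderiv ℝ (chartEndo e Θ) (e y) (chartEndo e Θ (e y) (chartDeriv e y (w y)))
          (chartDeriv e y (v y))) := by
  have hT := (contDiffAt_chartEndo he hΘ hy).differentiableAt (by simp)
  have happ : ∀ {v : VecField n M}, v.IsSmooth → ∀ u,
      fderiv ℝ (chartPush e (Θ.app v)) (e y) u =
        fderiv ℝ (chartEndo e Θ) (e y) u (chartDeriv e y (v y)) +
          chartEndo e Θ (e y) (fderiv ℝ (chartPush e v) (e y) u) := fun {v} hv u => by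
    have hd := (contDiffAt_chartPush he hy (hv y)).differentiableAt (by simp)
    have hE : chartPush e (Θ.app v) =ᶠ[𝓝 (e y)] fun z => chartEndo e Θ z (chartPush e v z) := by
      filter_upwards [e.open_target.mem_nhds (e.map_source hy)] with z hz
        using chartPush_app he Θ v hz
    rw [hE.fderiv_eq, fderiv_clm_apply hT hd]
    simp [chartPush_apply hy, add_comm]
  have hbr : ∀ {v w : VecField n M}, v.IsSmooth → w.IsSmooth →
      chartDeriv e y (VectorField.mlieBracket (𝓡 n) v w y) =
        fderiv ℝ (chartPush e w) (e y) (chartDeriv e y (v y)) -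
          fderiv ℝ (chartPush e v) (e y) (chartDeriv e y (w y)) := fun {v w} hv hw => by
    rw [chartPush_mlieBracket he hy (hv.mdifferentiableAt y) (hw.mdifferentiableAt y),
      chartPush_apply hy, chartPush_apply hy]
  have hv' := hΘ.app hv
  have hw' := hΘ.app hw
  have hΘv : chartDeriv e y (Θ.app v y) = chartEndo e Θ (e y) (chartDeriv e y (v y)) :=
    (chartEndo_apply he hy Θ (v y)).symm
  have hΘw : chartDeriv e y (Θ.app w y) = chartEndo e Θ (e y) (chartDeriv e y (w y)) :=
    (chartEndo_apply he hy Θ (w y)).symm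
  have h1 : Θ.nijenhuis v w y = Θ y (VectorField.mlieBracket (𝓡 n) (Θ.app v) w y)
      + Θ y (VectorField.mlieBracket (𝓡 n) v (Θ.app w) y)
      - VectorField.mlieBracket (𝓡 n) (Θ.app v) (Θ.app w) y
      - Θ y (Θ y (VectorField.mlieBracket (𝓡 n) v w y)) := rfl
  rw [h1]
  simp only [map_sub, map_add, ← chartEndo_apply he hy, hbr hv' hw, hbr hv hw', hbr hv' hw',
    hbr hv hw, happ hv, happ hw, hΘv, hΘw]
  abel

/-- Every tangent vector is the value of a global smooth field, so the hypothesis on global fields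
reaches all pairs of vectors. -/
lemma nijenhuisVanishesAt_chartEndo [T2Space M] (hΘ : Θ.IsSmooth) (hN : Θ.NijenhuisVanishes)
    (hy : y ∈ e.source) : NijenhuisVanishesAt (chartEndo e Θ) (e y) := by
  have hext : ∀ u : EuclideanSpace ℝ (Fin n), ∃ v : VecField n M, v.IsSmooth ∧
      chartDeriv e y (v y) = u := fun u => by
    obtain ⟨v, hv, hvu, -⟩ := exists_global_extension he (X := fun _ => u) hy
      (Filter.Eventually.of_forall fun z => contDiffAt_const) Filter.univ_mem
    exact ⟨v, hv, by rw [← chartPush_apply hy, hvu.eq_of_nhds]⟩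
  intro a b
  obtain ⟨v, hv, rfl⟩ := hext a
  obtain ⟨w, hw, rfl⟩ := hext b
  have h := chartDeriv_nijenhuis he hΘ hv hw hy
  rw [hN v w hv hw, Pi.zero_apply, map_zero, eq_comm, sub_eq_zero] at h
  exact h.symm

/-- Local kernel sections extend to global ones by a cutoff without changing their germs, and the
bracket depends on the germs only. -/
lemma kerPowInvolutiveAt_chartEndo [T2Space M] {k : ℕ} (hk : Θ.KerInvolutive k)
    (hy : y ∈ e.source) : KerPowInvolutiveAt (chartEndo e Θ) k (e y) := by
  intro X Y hX hY hXk hYk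
  have hext : ∀ X : EuclideanSpace ℝ (Fin n) → EuclideanSpace ℝ (Fin n),
      (∀ᶠ z in 𝓝 (e y), ContDiffAt ℝ ∞ X z) →
      (∀ᶠ z in 𝓝 (e y), (chartEndo e Θ z ^ k) (X z) = 0) →
      ∃ v : VecField n M, v.IsSmooth ∧ chartPush e v =ᶠ[𝓝 (e y)] X ∧
        ∀ x, (Θ x ^ k) (v x) = 0 := fun X hX hXk => by
    obtain ⟨v, hv, hvX, hv0⟩ := exists_global_extension he hy hX
      ((e.continuousAt hy).eventually hXk)
    refine ⟨v, hv, hvX, fun x => ?_⟩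
    obtain h | ⟨hxU, hx, c, hc⟩ := hv0 x
    · rw [h, map_zero]
    · apply chartDeriv_injective he hx
      rw [← chartEndo_pow_apply he hx, hc, map_smul, map_zero]
      rw [show (chartEndo e Θ (e x) ^ k) (X (e x)) = 0 from hxU, smul_zero]
  obtain ⟨v, hv, hvX, hv0⟩ := hext X hX hXk
  obtain ⟨w, hw, hwY, hw0⟩ := hext Y hY hYk
  have h := chartPush_mlieBracket he hy (hv.mdifferentiableAt y) (hw.mdifferentiableAt y)
  rw [hvX.fderiv_eq, hwY.fderiv_eq, hvX.eq_of_nhds, hwY.eq_of_nhds] at h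
  rw [← h, chartEndo_pow_apply he hy, hk v w hv hw hv0 hw0, map_zero]

end

/-- Membership in `W` says that the projection to `Wᗮ` vanishes, and this linear equation can be
differentiated. -/
lemma fderiv_mem_of_eventually_mem {W : Submodule ℝ (EuclideanSpace ℝ (Fin n))}
    {f : EuclideanSpace ℝ (Fin n) → EuclideanSpace ℝ (Fin n)} {x : EuclideanSpace ℝ (Fin n)}
    (hf : DifferentiableAt ℝ f x) (h : ∀ᶠ z in 𝓝 x, f z ∈ W) (u : EuclideanSpace ℝ (Fin n)) :
    fderiv ℝ f x u ∈ W := by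
  have h0 : (fun z => Wᗮ.starProjection (f z)) =ᶠ[𝓝 x] fun _ => 0 := by
    filter_upwards [h] with z hz
    rw [Submodule.starProjection_apply_eq_zero_iff]
    exact Submodule.le_orthogonal_orthogonal _ hz
  have h1 : HasFDerivAt (fun z => Wᗮ.starProjection (f z))
      (Wᗮ.starProjection ∘L fderiv ℝ f x) x :=
    (Wᗮ.starProjection).hasFDerivAt.comp x hf.hasFDerivAt
  have h2 := h1.fderiv
  rw [h0.fderiv_eq] at h2
  have h3 : Wᗮ.starProjection (fderiv ℝ f x u) = 0 := by
    have := congrArg (fun g => g u) h2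
    simpa using this.symm
  rwa [Submodule.starProjection_apply_eq_zero_iff, Submodule.orthogonal_orthogonal] at h3

/-- The easy half of Frobenius: in an adapted chart both fields take values in a fixed `W`, hence so
do their derivatives and the bracket. -/
lemma IsIntegrableDistribution.mlieBracket_mem {D : (x : M) → Submodule ℝ (TangentSpace (𝓡 n) x)}
    (hD : IsIntegrableDistribution D) {v w : VecField n M} (hv : v.IsSmooth) (hw : w.IsSmooth)
    (hvD : ∀ x, v x ∈ D x) (hwD : ∀ x, w x ∈ D x) (x : M) :
    VectorField.mlieBracket (𝓡 n) v w x ∈ D x := by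
  obtain ⟨e, he, hx, W, hW⟩ := hD x
  have hmem : ∀ {v : VecField n M}, v.IsSmooth → (∀ x, v x ∈ D x) → ∀ u,
      fderiv ℝ (chartPush e v) (e x) u ∈ W := fun {v} hv hvD u => by
    refine fderiv_mem_of_eventually_mem
      ((contDiffAt_chartPush he hx (hv x)).differentiableAt (by simp)) ?_ u
    filter_upwards [e.open_target.mem_nhds (e.map_source hx)] with z hz
    exact (hW _ (e.map_target hz) _).1 (hvD _)
  refine (hW x hx _).2 ?_
  have h := chartPush_mlieBracket he hx (hv.mdifferentiableAt x) (hw.mdifferentiableAt x)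
  exact h ▸ W.sub_mem (hmem hw hwD _) (hmem hv hvD _)

lemma kerInvolutive_of_isIntegrableDistribution (hn : 1 ≤ n)
    (h : ∀ i ∈ Finset.Icc 1 n, IsIntegrableDistribution (Θ.kerPow i)) (k : ℕ) :
    Θ.KerInvolutive k := by
  have key : ∀ i ∈ Finset.Icc 1 n, Θ.KerInvolutive i := fun i hi v w hv hw hv0 hw0 x =>
    (h i hi).mlieBracket_mem hv hw hv0 hw0 x
  by_cases hkn : k ≤ n
  · rcases Nat.eq_zero_or_pos k with rfl | hk
    · intro v w _ _ hv0 hw0 x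
      have hv' : v = 0 := funext hv0
      subst hv'
      change VectorField.mlieBracket (𝓡 n) 0 w x = 0
      rw [VectorField.mlieBracket_zero_left]
      rfl
    · exact key k (Finset.mem_Icc.2 ⟨hk, hkn⟩)
  -- Kernels of powers stabilise at exponent n, the dimension, so larger exponents bring nothing
  -- new.
  · have hker : ∀ (x : M) (v : TangentSpace (𝓡 n) x), (Θ x ^ k) v = 0 ↔ (Θ x ^ n) v = 0 := by
      intro x v
      have hfin : Module.finrank ℝ (TangentSpace (𝓡 n) x) = n :=
        finrank_euclideanSpace_fin
      have : FiniteDimensional ℝ (TangentSpace (𝓡 n) x) :=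
        inferInstanceAs (FiniteDimensional ℝ (EuclideanSpace ℝ (Fin n)))
      have h1 := Module.End.ker_pow_eq_ker_pow_finrank_of_le (f := (Θ x).toLinearMap) (m := k)
        (by rw [hfin]; omega)
      rw [hfin] at h1
      have h2 := SetLike.ext_iff.1 h1 v
      simpa [← ContinuousLinearMap.toLinearMap_pow] using h2
    intro v w hv hw hv0 hw0 x
    rw [hker]
    exact key n (Finset.mem_Icc.2 ⟨hn, le_rfl⟩) v w hv hw (fun x => (hker x _).1 (hv0 x))
      (fun x => (hker x _).1 (hw0 x)) x

/-- Writing [v, w] = ∇_v w - ∇_w v and moving Θ through ∇, the terms of N cancel in pairs. -/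
lemma EndoField.Integrable.nijenhuisVanishes (hΘ : Θ.IsSmooth) (h : Θ.Integrable) :
    Θ.NijenhuisVanishes := by
  obtain ⟨cov, -, htor, hpar⟩ := h
  rw [CovariantDerivative.torsion_eq_zero_iff] at htor
  intro v w hv hw
  have hv' := hΘ.app hv
  have hw' := hΘ.app hw
  have hbr : ∀ {v w : VecField n M}, v.IsSmooth → w.IsSmooth → ∀ x,
      VectorField.mlieBracket (𝓡 n) v w x = cov w x (v x) - cov v x (w x) :=
    fun {v w} hv hw x => (htor (hv.mdifferentiableAt x) (hw.mdifferentiableAt x)).symm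
  have hcomm : ∀ {v : VecField n M}, v.IsSmooth → ∀ x u, cov (Θ.app v) x u = Θ x (cov v x u) :=
    fun {v} hv x u => sub_eq_zero.1 (hpar v hv x u)
  funext x
  change Θ x (VectorField.mlieBracket (𝓡 n) (Θ.app v) w x)
      + Θ x (VectorField.mlieBracket (𝓡 n) v (Θ.app w) x)
      - VectorField.mlieBracket (𝓡 n) (Θ.app v) (Θ.app w) x
      - Θ x (Θ x (VectorField.mlieBracket (𝓡 n) v w x)) = 0
  simp only [hbr hv' hw, hbr hv hw', hbr hv' hw', hbr hv hw, hcomm hv, hcomm hw, map_sub]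
  abel

/-- Since Θ is parallel, covariant derivatives of sections of Ker Θ^k stay in Ker Θ^k (induction on
`k`, applied to Θv); brackets are differences of such derivatives. -/
lemma EndoField.Integrable.kerInvolutive (hΘ : Θ.IsSmooth) (h : Θ.Integrable) (k : ℕ) :
    Θ.KerInvolutive k := by
  obtain ⟨cov, -, htor, hpar⟩ := h
  rw [CovariantDerivative.torsion_eq_zero_iff] at htor
  have hpow : ∀ (k : ℕ) (v : VecField n M), v.IsSmooth → (∀ x, (Θ x ^ k) (v x) = 0) →
      ∀ x u, (Θ x ^ k) (cov v x u) = 0 := by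
    intro k
    induction k with
    | zero =>
      intro v _ hv0 x u
      have hv' : v = 0 := funext hv0
      subst hv'
      rw [cov.zero]
      rfl
    | succ k ih =>
      intro v hv hv0 x u
      have := ih (Θ.app v) (hΘ.app hv)
        (fun x => by have := hv0 x; rw [pow_succ] at this; exact this) x u
      rw [sub_eq_zero.1 (hpar v hv x u)] at this
      rw [pow_succ]
      exact this
  intro v w hv hw hv0 hw0 x
  rw [← htor (hv.mdifferentiableAt x) (hw.mdifferentiableAt x), map_sub, hpow k w hw hw0,
    hpow k v hv hv0, sub_zero]

/-- A local diffeomorphism of the model space composed with a chart is a chart. -/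
lemma exists_chart_of_coordinates (he : e ∈ IsManifold.maximalAtlas (𝓡 n) ∞ M) (hy : y ∈ e.source)
    {F : EuclideanSpace ℝ (Fin n) → EuclideanSpace ℝ (Fin n)}
    (hF : ∀ᶠ z in 𝓝 (e y), ContDiffAt ℝ ∞ F z)
    {L : EuclideanSpace ℝ (Fin n) ≃L[ℝ] EuclideanSpace ℝ (Fin n)}
    (hL : HasFDerivAt F (L : EuclideanSpace ℝ (Fin n) →L[ℝ] EuclideanSpace ℝ (Fin n)) (e y))
    {s : Set (EuclideanSpace ℝ (Fin n))} (hs : s ∈ 𝓝 (e y)) :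
    ∃ e' ∈ IsManifold.maximalAtlas (𝓡 n) ∞ M, y ∈ e'.source ∧ e'.source ⊆ e.source ∧
      ∀ x ∈ e'.source, e x ∈ s ∧ ∀ v, chartDeriv e' x v = fderiv ℝ F (e x) (chartDeriv e x v) := by
  obtain ⟨R, hR, hRF, hRs, hR1, hR2⟩ := exists_smooth_openPartialHomeomorph hF hL hs
  have hsub : ∀ {x}, x ∈ (e.trans R).source → x ∈ e.source ∧ e x ∈ R.source := fun hx => by
    simpa [OpenPartialHomeomorph.trans_source] using hx
  refine ⟨e.trans R, ?_, ?_, fun x hx => (hsub hx).1, fun x hx => ⟨hRs (hsub hx).2, fun v => ?_⟩⟩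
  · refine (IsManifold.mem_maximalAtlas_iff_contMDiffOn _).2 ⟨?_, ?_⟩
    · intro x hx
      have h1 := (hR1 _ (hsub hx).2).1.contMDiffAt.comp x
        (contMDiffAt_of_mem_maximalAtlas he (hsub hx).1)
      rw [OpenPartialHomeomorph.coe_trans, hRF]
      exact h1.contMDiffWithinAt
    · intro z hz
      rw [OpenPartialHomeomorph.trans_target] at hz
      have h1 := (contMDiffAt_symm_of_mem_maximalAtlas he hz.2).comp z
        (hR2 z hz.1).contMDiffAt
      exact h1.contMDiffWithinAt
  · simpa [OpenPartialHomeomorph.trans_source] using ⟨hy, hR⟩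
  · have h1 := (contMDiffAt_of_mem_maximalAtlas he (hsub hx).1).mdifferentiableAt
      (I := 𝓡 n) (I' := 𝓡 n) (n := ∞) (by simp)
    have h2 := ((hR1 _ (hsub hx).2).1.differentiableAt (by simp)).mdifferentiableAt
    have h3 := mfderiv_comp x h2 h1
    rw [mfderiv_eq_fderiv] at h3
    rw [chartDeriv, OpenPartialHomeomorph.coe_trans, hRF, h3]
    rfl

/-- Reduces the search for adapted charts to a smooth map F between open sets of ℝⁿ intertwining Θ
with a constant `A`; shrinking the domain turns F into a coordinate change. -/
lemma locallyConstant_of_coordinates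
    (h : ∀ x : M, ∃ e ∈ IsManifold.maximalAtlas (𝓡 n) ∞ M, x ∈ e.source ∧
      ∃ (F : EuclideanSpace ℝ (Fin n) → EuclideanSpace ℝ (Fin n))
        (L : EuclideanSpace ℝ (Fin n) ≃L[ℝ] EuclideanSpace ℝ (Fin n))
        (A : EuclideanSpace ℝ (Fin n) →L[ℝ] EuclideanSpace ℝ (Fin n)),
        (∀ᶠ z in 𝓝 (e x), ContDiffAt ℝ ∞ F z) ∧
        HasFDerivAt F (L : EuclideanSpace ℝ (Fin n) →L[ℝ] EuclideanSpace ℝ (Fin n)) (e x) ∧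
        ∀ᶠ z in 𝓝 (e x), ∀ v, fderiv ℝ F z (chartEndo e Θ z v) = A (fderiv ℝ F z v)) :
    Θ.LocallyConstant := by
  intro x
  obtain ⟨e, he, hx, F, L, A, hF, hL, hA⟩ := h x
  obtain ⟨e', he', hx', hsub, h'⟩ := exists_chart_of_coordinates he hx hF hL hA
  refine ⟨e', he', hx', A, fun y hy v => ?_⟩
  change chartDeriv e' y (Θ y v) = A (chartDeriv e' y v)
  obtain ⟨hys, hyF⟩ := h' y hy
  rw [hyF, hyF, ← chartEndo_apply he (hsub hy), hys]

/-- Common route from (i) and from (iv) to (iii): the coordinate expression of Θ in a chart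
satisfies the assumptions of `exists_normal_form`. -/
theorem locallyConstant_of_involutive [T2Space M] (hΘ : Θ.IsSmooth)
    (hconst : Θ.AlgebraicallyConstant) (hnil : Θ.Nilpotent) (hN : Θ.NijenhuisVanishes)
    (hker : ∀ k, Θ.KerInvolutive k) : Θ.LocallyConstant := by
  refine locallyConstant_of_coordinates fun x => ?_
  have he : chartAt (EuclideanSpace ℝ (Fin n)) x ∈ IsManifold.maximalAtlas (𝓡 n) ∞ M :=
    IsManifold.chart_mem_maximalAtlas x
  set e := chartAt (EuclideanSpace ℝ (Fin n)) x
  have hx : x ∈ e.source := mem_chart_source _ x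
  have hev : ∀ {p : EuclideanSpace ℝ (Fin n) → Prop}, (∀ y ∈ e.source, p (e y)) →
      ∀ᶠ z in 𝓝 (e x), p z := fun {p} h => by
    filter_upwards [e.open_target.mem_nhds (e.map_source hx)] with z hz
    have := h _ (e.map_target hz)
    rwa [e.right_inv hz] at this
  obtain ⟨F, hF, hF0, hFΘ⟩ := exists_normal_form (eventually_contDiffAt_chartEndo he hΘ hx)
    (hev fun y hy => chartEndo_conj he hconst hx hy) (isNilpotent_chartEndo he hx (hnil x))
    (hev fun y hy => nijenhuisVanishesAt_chartEndo he hΘ hN hy)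
    (fun k => hev fun y hy => kerPowInvolutiveAt_chartEndo he (hker k) hy)
  refine ⟨e, he, hx, F, ContinuousLinearEquiv.refl ℝ _, chartEndo e Θ (e x), hF, ?_, hFΘ⟩
  have := (hF.self_of_nhds.differentiableAt (by simp)).hasFDerivAt
  rw [hF0] at this
  exact this

theorem EndoField.LocallyConstant.nijenhuisVanishes (hΘ : Θ.IsSmooth) (h : Θ.LocallyConstant) :
    Θ.NijenhuisVanishes := by
  intro v w hv hw
  funext x
  obtain ⟨e, he, hx, A, hA⟩ := h x
  apply chartDeriv_injective he hx
  have hc : chartEndo e Θ =ᶠ[𝓝 (e x)] fun _ => A := by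
    filter_upwards [e.open_target.mem_nhds (e.map_source hx)] with z hz
    have := chartEndo_eq_of_forall he (e.map_target hz) (hA _ (e.map_target hz))
    rwa [e.right_inv hz] at this
  rw [chartDeriv_nijenhuis he hΘ hv hw hx, hc.fderiv_eq]
  simp

end Transfer

/-! ### Jordan bases of nilpotent endomorphisms. -/

section Jordan

open Polynomial Module

/-- The monomial basis of `ℝ[X] / (X ^ k)`, by decreasing degree. -/
def monomialBasis (k : ℕ) : Basis (Fin k) ℝ (ℝ[X] ⧸ ℝ[X] ∙ (X : ℝ[X]) ^ k) :=
  ((AdjoinRoot.powerBasis' (monic_X_pow (R := ℝ) k)).basis).reindex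
    ((finCongr (by simp)).trans Fin.revPerm)

lemma monomialBasis_apply (k : ℕ) (j : Fin k) :
    monomialBasis k j = Submodule.Quotient.mk (X ^ (k - (j + 1))) := by
  have h : ((AdjoinRoot.powerBasis' (monic_X_pow (R := ℝ) k)).basis).reindex
      ((finCongr (by simp)).trans Fin.revPerm) j =
      AdjoinRoot.root ((X : ℝ[X]) ^ k) ^ (k - ((j : ℕ) + 1)) := by
    rw [Basis.reindex_apply, PowerBasis.basis_eq_pow]
    simp
  refine Eq.trans h ?_
  rw [AdjoinRoot.root, ← map_pow]
  rfl

/-- Index `j` carries the degree k - 1 - j. Multiplication by X raises the degree, hence lowers the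
index by one, and index 0 goes to X^k = 0. -/
lemma X_smul_monomialBasis (k : ℕ) (j : Fin k) :
    (X : ℝ[X]) • monomialBasis k j = 0 ∨
      ∃ j' : Fin k, (j' : ℕ) + 1 = j ∧ (X : ℝ[X]) • monomialBasis k j = monomialBasis k j' := by
  obtain ⟨j, hj⟩ := j
  rw [monomialBasis_apply, ← Submodule.Quotient.mk_smul, smul_eq_mul, ← pow_succ']
  cases j with
  | zero =>
    left
    rw [Submodule.Quotient.mk_eq_zero]
    have : k - (0 + 1) + 1 = k := by omega
    rw [this]
    exact Submodule.mem_span_singleton_self _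
  | succ j =>
    right
    refine ⟨⟨j, by omega⟩, rfl, ?_⟩
    rw [monomialBasis_apply]
    congr 2
    simp only
    omega

variable {V : Type*} [AddCommGroup V] [Module ℝ V] [FiniteDimensional ℝ V]

-- As a module over ℝ[X] with X acting by `A`, the space is X-power torsion, so the structure
-- theorem over a principal ideal domain applies with the single prime X.
open DirectSum in
lemma exists_aeval_decomposition {A : Module.End ℝ V} (hA : IsNilpotent A) :
    ∃ (d : ℕ) (k : Fin d → ℕ),
      Nonempty (AEval' A ≃ₗ[ℝ[X]] ⨁ i, ℝ[X] ⧸ ℝ[X] ∙ (X : ℝ[X]) ^ (k i : ℕ)) := by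
  have : Module.Finite ℝ[X] (AEval' A) := inferInstance
  refine Module.torsion_by_prime_power_decomposition Polynomial.irreducible_X ?_
  obtain ⟨m, hm⟩ := hA
  intro x
  obtain ⟨v, rfl⟩ := (AEval'.of A).surjective x
  refine ⟨⟨X ^ m, m, rfl⟩, ?_⟩
  change (X ^ m : ℝ[X]) • (AEval'.of A) v = 0
  have : ∀ m : ℕ, (X ^ m : ℝ[X]) • (AEval'.of A) v = AEval'.of A ((A ^ m) v) := by
    intro m
    induction m with
    | zero => simp
    | succ m ih => rw [pow_succ', mul_smul, ih, AEval'.X_smul_of, pow_succ']; rfl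
  rw [this, hm]
  simp

lemma dfinsuppBasis_apply {ι R : Type*} [DecidableEq ι] [Semiring R] {N : ι → Type*}
    [∀ i, AddCommMonoid (N i)] [∀ i, Module R (N i)] {η : ι → Type*}
    (b : ∀ i, Basis (η i) R (N i)) (i : ι) (j : η i) :
    DFinsupp.basis b ⟨i, j⟩ = DFinsupp.single i (b i j) := by
  classical
  rw [Basis.apply_eq_iff]
  ext ⟨i', j'⟩
  change (b i').repr (DFinsupp.single i (b i j) i') j' = _
  by_cases h : i = i'
  · subst h
    simp [Finsupp.single_apply]
  · rw [DFinsupp.single_eq_of_ne (Ne.symm h), Finsupp.single_eq_of_ne]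
    · simp
    · rintro ⟨⟩
      exact h rfl

-- The bases of the summands are concatenated block by block. Each block occupies consecutive
-- indices, so the predecessor inside a block is also the predecessor in `Fin n`.
open DirectSum in
omit [FiniteDimensional ℝ V] in
lemma exists_jordan_basis_of_decomposition {n : ℕ} (hn : finrank ℝ V = n) {A : Module.End ℝ V}
    {d : ℕ} {k : Fin d → ℕ} {N : Fin d → Type*} [∀ i, AddCommGroup (N i)]
    [∀ i, Module ℝ[X] (N i)] [∀ i, Module ℝ (N i)] [∀ i, IsScalarTower ℝ ℝ[X] (N i)]
    (b : ∀ i, Basis (Fin (k i)) ℝ (N i))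
    (hb : ∀ i j, (X : ℝ[X]) • b i j = 0 ∨
      ∃ j' : Fin (k i), (j' : ℕ) + 1 = j ∧ (X : ℝ[X]) • b i j = b i j')
    (φ : AEval' A ≃ₗ[ℝ[X]] ⨁ i, N i) : ∃ b : Basis (Fin n) ℝ V,
      ∀ i, A (b i) = 0 ∨ ∃ j : Fin n, (j : ℕ) + 1 = i ∧ A (b i) = b j := by
  let c : Basis (Σ i : Fin d, Fin (k i)) ℝ V :=
    ((DFinsupp.basis b).map ((φ.restrictScalars ℝ).symm)).map (AEval'.of A).symm
  have hc : ∀ i j, AEval'.of A (c ⟨i, j⟩) = φ.symm (DFinsupp.single i (b i j)) := by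
    intro i j
    rw [← dfinsuppBasis_apply]
    exact (AEval'.of A).apply_symm_apply _
  have hA' : ∀ i j, AEval'.of A (A (c ⟨i, j⟩)) =
      φ.symm (DFinsupp.single i ((X : ℝ[X]) • b i j)) := by
    intro i j
    rw [← AEval'.X_smul_of, hc, ← map_smul, ← DFinsupp.single_smul]
  have hcard : ∑ i, k i = n := by
    rw [← hn, Module.finrank_eq_card_basis c]
    simp
  let σ : (Σ i : Fin d, Fin (k i)) ≃ Fin n := finSigmaFinEquiv.trans (finCongr hcard)
  refine ⟨c.reindex σ, fun l => ?_⟩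
  obtain ⟨⟨i, j⟩, rfl⟩ := σ.surjective l
  simp only [Basis.reindex_apply, Equiv.symm_apply_apply]
  rcases hb i j with h | ⟨j', hj', h⟩
  · left
    apply (AEval'.of A).injective
    rw [hA', h]
    simp
  · right
    refine ⟨σ ⟨i, j'⟩, ?_, ?_⟩
    · simp only [σ, Equiv.trans_apply, finCongr_apply, Fin.val_cast, finSigmaFinEquiv_apply]
      omega
    · apply (AEval'.of A).injective
      rw [hA', h, Equiv.symm_apply_apply, hc]

/-- Jordan normal form of a nilpotent endomorphism. -/
theorem exists_jordan_basis {n : ℕ} (hn : finrank ℝ V = n) {A : Module.End ℝ V}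
    (hA : IsNilpotent A) : ∃ b : Basis (Fin n) ℝ V,
      ∀ i, A (b i) = 0 ∨ ∃ j : Fin n, (j : ℕ) + 1 = i ∧ A (b i) = b j := by
  obtain ⟨d, k, ⟨φ⟩⟩ := exists_aeval_decomposition hA
  exact exists_jordan_basis_of_decomposition hn (fun i => monomialBasis (k i))
    (fun i => X_smul_monomialBasis (k i)) φ

end Jordan

/-! ### Straightening a commuting frame. -/

section CommutingFrames

universe u

open Module

variable {V : Type u} [NormedAddCommGroup V] [NormedSpace ℝ V] [FiniteDimensional ℝ V]

/-- A commuting frame is the coordinate frame of some coordinates. -/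
theorem exists_straightening_of_commuting {ι : Type*} [Fintype ι] {b : Basis ι ℝ V}
    {f : ι → V → V} {x₀ : V} (hf : ∀ i, ∀ᶠ x in 𝓝 x₀, ContDiffAt ℝ ∞ (f i) x)
    (hb : ∀ i, f i x₀ = b i)
    (hcomm : ∀ i j, ∀ᶠ x in 𝓝 x₀, fderiv ℝ (f j) x (f i x) = fderiv ℝ (f i) x (f j x)) :
    ∃ F : V → V, (∀ᶠ x in 𝓝 x₀, ContDiffAt ℝ ∞ F x) ∧
      fderiv ℝ F x₀ = ContinuousLinearMap.id ℝ V ∧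
      ∀ᶠ x in 𝓝 x₀, (∀ i, fderiv ℝ F x (f i x) = b i) ∧
        Submodule.span ℝ (Set.range fun i => f i x) = ⊤ := by
  have : CompleteSpace V := FiniteDimensional.complete ℝ V
  let g : V → V →L[ℝ] V := fun x =>
    ∑ i, (LinearMap.toContinuousLinearMap (b.coord i)).smulRight (f i x)
  have hgb : ∀ x i, g x (b i) = f i x := fun x i => by
    classical
    simp [g, Finsupp.single_apply]
  have hg : ∀ᶠ x in 𝓝 x₀, ContDiffAt ℝ ∞ g x := by
    filter_upwards [Filter.eventually_all.2 hf] with x hx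
    refine ContDiffAt.sum fun i _ => ?_
    exact contDiffAt_const.smulRight (hx i)
  have hg₀ : g x₀ = ContinuousLinearMap.id ℝ V := by
    refine ContinuousLinearMap.coe_injective (b.ext fun i => ?_)
    simp [hgb, hb]
  let α : V → V →L[ℝ] V := fun x => (g x).inverse
  have hα : ∀ᶠ x in 𝓝 x₀, ContDiffAt ℝ ∞ α x ∧ (∀ v, g x (α x v) = v) ∧
      ∀ v, α x (g x v) = v := eventually_inverse_frame hg hg₀
  have hspan : ∀ᶠ x in 𝓝 x₀, Submodule.span ℝ (Set.range fun i => f i x) = ⊤ := by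
    filter_upwards [hα] with x hx
    have h1 : LinearMap.range (g x).toLinearMap = ⊤ :=
      LinearMap.range_eq_top.2 fun v => ⟨_, hx.2.1 v⟩
    rw [← h1, LinearMap.range_eq_map, ← b.span_eq, Submodule.map_span, ← Set.range_comp]
    congr 2
    ext i
    exact (hgb x i).symm
  have hsymm : ∀ᶠ x in 𝓝 x₀, ∀ u v, fderiv ℝ α x u v = fderiv ℝ α x v u := by
    filter_upwards [hα.eventually_nhds, Filter.eventually_all.2 hf, hspan,
      Filter.eventually_all.2 fun i => Filter.eventually_all.2 fun j => hcomm i j]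
      with x hαx hfx hspanx hcx
    have hαd := hαx.self_of_nhds.1.differentiableAt (by simp)
    -- α is the dual coframe: it sends `f j` to the constant `b j`. Differentiating this trades
    -- derivatives of α for derivatives of the frame, and commutation becomes closedness of α.
    have h1 : ∀ u j, fderiv ℝ α x u (f j x) = - α x (fderiv ℝ (f j) x u) := fun u j => by
      have h0 : (fun z => α z (f j z)) =ᶠ[𝓝 x] fun _ => b j := by
        filter_upwards [hαx] with z hz
        rw [← hgb, hz.2.2]
      have h2 := (hαd.hasFDerivAt.clm_apply
        ((hfx j).differentiableAt (by simp)).hasFDerivAt).fderiv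
      rw [h0.fderiv_eq, fderiv_const_apply] at h2
      have h3 := DFunLike.congr_fun h2 u
      simp only [zero_apply, add_apply, ContinuousLinearMap.comp_apply,
        ContinuousLinearMap.flip_apply] at h3
      exact eq_neg_of_add_eq_zero_right h3.symm
    have h2 : fderiv ℝ α x = (fderiv ℝ α x).flip := by
      refine ContinuousLinearMap.coe_injective (LinearMap.ext_on_range hspanx fun i => ?_)
      refine ContinuousLinearMap.coe_injective (LinearMap.ext_on_range hspanx fun j => ?_)
      simp only [ContinuousLinearMap.coe_coe, ContinuousLinearMap.flip_apply, h1, hcx i j]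
    intro u v
    exact congrArg (fun T => T u v) h2
  -- With η = 0 the distribution is the whole tangent space and the Frobenius statement becomes the
  -- Poincaré lemma.
  obtain ⟨F, hF, hFα, hF₀⟩ := exists_primitive_along (D := V) (C := PUnit.{u + 1})
    (p := ContinuousLinearMap.id ℝ V) (η := fun _ => 0) (α := α) (x₀ := x₀)
    (Filter.Eventually.of_forall fun x => contDiffAt_const) (hα.mono fun x hx => hx.1)
    (ContinuousLinearEquiv.prodUnique ℝ V PUnit.{u + 1}).symm (fun v => rfl)
    (Filter.Eventually.of_forall fun x u v _ _ => by simp)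
    (hsymm.mono fun x hx u v _ _ => hx u v) (α x₀) (fun _ _ => rfl)
  refine ⟨F, hF, ?_, ?_⟩
  · rw [hF₀]
    simp only [α, hg₀, ContinuousLinearMap.inverse_id]
  · filter_upwards [hFα, hα, hspan] with x h1 h2 h3
    refine ⟨fun i => ?_, h3⟩
    rw [h1 _ rfl, ← hgb, h2.2.2]

end CommutingFrames

/-! ### Equivalence of commuting Jordan frames and local constancy. -/

section JordanFrames

open Module

variable {n : ℕ} {M : Type*} [TopologicalSpace M] [ChartedSpace (EuclideanSpace ℝ (Fin n)) M]
  [IsManifold (𝓡 n) ∞ M] {Θ : EndoField n M}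

/-- The constant matrix of Θ inherits nilpotency; a Jordan basis of it, viewed as constant fields in
the chart, is the required frame. -/
theorem EndoField.LocallyConstant.hasCommutingJordanFrames (hnil : Θ.Nilpotent)
    (h : Θ.LocallyConstant) : Θ.HasCommutingJordanFrames := by
  intro x
  obtain ⟨e, he, hx, A, hA⟩ := h x
  have hAnil : IsNilpotent A.toLinearMap := by
    have h1 := isNilpotent_chartEndo he hx (hnil x)
    rw [chartEndo_eq_of_forall he hx (hA x hx)] at h1
    obtain ⟨k, hk⟩ := h1
    exact ⟨k, by rw [← ContinuousLinearMap.toLinearMap_pow, hk]; rfl⟩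
  obtain ⟨b, hb⟩ := exists_jordan_basis finrank_euclideanSpace_fin hAnil
  have hpush : ∀ (i : Fin n), ∀ y ∈ e.source,
      chartDeriv e y (chartPull e (fun _ => b i) y) = b i :=
    fun i y hy => chartDeriv_chartPull he _ hy
  have hsm : ∀ i, ∀ y ∈ e.source, ContMDiffAt (𝓡 n) ((𝓡 n).prod 𝓘(ℝ, EuclideanSpace ℝ (Fin n))) ∞
      (fun x => (⟨x, chartPull e (fun _ => b i) x⟩ : Bundle.TotalSpace (EuclideanSpace ℝ (Fin n))
        (TangentSpace (𝓡 n) : M → Type _))) y :=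
    fun i y hy => contMDiffAt_chartPull he hy contDiffAt_const
  refine ⟨e.source, e.open_source, hx, fun i => chartPull e fun _ => b i, ⟨?_, ?_, ?_⟩, ?_, ?_⟩
  · intro y hy
    refine LinearIndependent.of_comp (chartDeriv e y).toLinearMap ?_
    convert! b.linearIndependent using 1
    ext1 i
    exact hpush i y hy
  · intro y hy
    have h1 : LinearMap.range (chartDerivInv e y).toLinearMap = ⊤ :=
      LinearMap.range_eq_top.2 fun v => ⟨_, chartDerivInv_chartDeriv he hy v⟩
    rw [← h1, LinearMap.range_eq_map, ← b.span_eq, Submodule.map_span, ← Set.range_comp]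
    exact le_rfl
  · exact fun i y hy => (hsm i y hy).contMDiffWithinAt
  · intro i j y hy
    apply chartDeriv_injective he hy
    have hc : ∀ i, chartPush e (chartPull e fun _ => b i) =ᶠ[𝓝 (e y)] fun _ => b i := fun i => by
      filter_upwards [e.open_target.mem_nhds (e.map_source hy)] with z hz
        using chartPush_chartPull he _ hz
    rw [chartPush_mlieBracket he hy ((hsm i y hy).mdifferentiableAt (by simp))
      ((hsm j y hy).mdifferentiableAt (by simp)), (hc i).fderiv_eq, (hc j).fderiv_eq]
    simp
  · intro i
    have hΘ : ∀ y ∈ e.source, chartDeriv e y (Θ y (chartPull e (fun _ => b i) y)) = A (b i) :=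
      fun y hy => (hA y hy _).trans (congrArg A (hpush i y hy))
    rcases hb i with h0 | ⟨j, hj, hij⟩
    · refine Or.inl fun y hy => chartDeriv_injective he hy ?_
      rw [hΘ y hy, map_zero]
      exact h0
    · refine Or.inr ⟨j, hj, fun y hy => chartDeriv_injective he hy ?_⟩
      rw [hΘ y hy, hpush j y hy]
      exact hij

/-- In coordinates that straighten the frame, the matrix of Θ is its matrix in the frame, which is
constant. -/
theorem EndoField.HasCommutingJordanFrames.locallyConstant
    (h : Θ.HasCommutingJordanFrames) : Θ.LocallyConstant := by
  refine locallyConstant_of_coordinates fun x => ?_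
  have he : chartAt (EuclideanSpace ℝ (Fin n)) x ∈ IsManifold.maximalAtlas (𝓡 n) ∞ M :=
    IsManifold.chart_mem_maximalAtlas x
  set e := chartAt (EuclideanSpace ℝ (Fin n)) x
  have hx : x ∈ e.source := mem_chart_source _ x
  obtain ⟨U, hU, hxU, f, hf, hcomm, hJ⟩ := h x
  have hev : ∀ {p : EuclideanSpace ℝ (Fin n) → Prop}, (∀ y ∈ e.source, y ∈ U → p (e y)) →
      ∀ᶠ z in 𝓝 (e x), p z := fun {p} h => by
    have hc := e.continuousAt_symm (e.map_source hx)
    rw [ContinuousAt, e.left_inv hx] at hc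
    filter_upwards [e.open_target.mem_nhds (e.map_source hx), hc (hU.mem_nhds hxU)] with z hz hz'
    have := h _ (e.map_target hz) hz'
    rwa [e.right_inv hz] at this
  have hfs : ∀ i, ∀ y ∈ U, ContMDiffAt (𝓡 n) ((𝓡 n).prod 𝓘(ℝ, EuclideanSpace ℝ (Fin n))) ∞
      (fun x => (⟨x, f i x⟩ : Bundle.TotalSpace (EuclideanSpace ℝ (Fin n))
        (TangentSpace (𝓡 n) : M → Type _))) y :=
    fun i y hy => (hf.contMDiffOn i).contMDiffAt (hU.mem_nhds hy)
  let b₀ : Basis (Fin n) ℝ (TangentSpace (𝓡 n) x) :=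
    Basis.mk (hf.linearIndependent hxU) (hf.generating hxU)
  let E : TangentSpace (𝓡 n) x ≃L[ℝ] EuclideanSpace ℝ (Fin n) :=
    (mdifferentiable_of_mem_maximalAtlas he).mfderiv hx
  let b : Basis (Fin n) ℝ (EuclideanSpace ℝ (Fin n)) := b₀.map E.toLinearEquiv
  have hb : ∀ i, chartPush e (f i) (e x) = b i := fun i => by
    rw [chartPush_apply hx, Basis.map_apply, Basis.mk_apply]
    rfl
  obtain ⟨F, hF, hF₀, hFb⟩ := exists_straightening_of_commuting (b := b)
    (f := fun i => chartPush e (f i)) (x₀ := e x)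
    (fun i => hev fun y hy hyU => contDiffAt_chartPush he hy (hfs i y hyU)) hb
    (fun i j => hev fun y hy hyU => by
      have h1 := chartPush_mlieBracket he hy ((hfs i y hyU).mdifferentiableAt (by simp))
        ((hfs j y hyU).mdifferentiableAt (by simp))
      rw [hcomm i j y hyU, map_zero, eq_comm, sub_eq_zero] at h1
      exact h1)
  refine ⟨e, he, hx, F, ContinuousLinearEquiv.refl ℝ _, chartEndo e Θ (e x), hF, ?_, ?_⟩
  · have := (hF.self_of_nhds.differentiableAt (by simp)).hasFDerivAt
    rw [hF₀] at this
    exact this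
  -- The Jordan alternative depends on the index and not on the point, so the matrix of Θ in the
  -- frame at z is the one at the base point.
  · have hΘ : ∀ᶠ z in 𝓝 (e x), ∀ i, (chartEndo e Θ z (chartPush e (f i) z) = 0 ∧
          chartEndo e Θ (e x) (b i) = 0) ∨
        ∃ j, chartEndo e Θ z (chartPush e (f i) z) = chartPush e (f j) z ∧
          chartEndo e Θ (e x) (b i) = b j := by
      refine hev fun y hy hyU i => ?_
      simp only [← hb]
      rw [chartPush_apply hy, chartPush_apply hx, chartEndo_apply he hy, chartEndo_apply he hx]
      rcases hJ i with h0 | ⟨j, -, hj⟩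
      · left
        simp [h0 y hyU, h0 x hxU]
      · refine Or.inr ⟨j, ?_, ?_⟩
        · rw [hj y hyU, chartPush_apply hy]
        · rw [hj x hxU, chartPush_apply hx]
    filter_upwards [hFb, hΘ] with z h1 h2 v
    have h3 : (fderiv ℝ F z).comp (chartEndo e Θ z) =
        (chartEndo e Θ (e x)).comp (fderiv ℝ F z) := by
      refine ContinuousLinearMap.coe_injective (LinearMap.ext_on_range h1.2 fun i => ?_)
      simp only [ContinuousLinearMap.coe_coe, ContinuousLinearMap.comp_apply, h1.1]
      rcases h2 i with ⟨h4, h5⟩ | ⟨j, h4, h5⟩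
      · rw [h4, h5, map_zero]
      · rw [h4, h5, h1.1]
    exact congrArg (fun T => T v) h3

end JordanFrames

/-! ### The flat connection of a chart. -/

section ChartConnection

variable {n : ℕ} {M : Type*} [TopologicalSpace M] [ChartedSpace (EuclideanSpace ℝ (Fin n)) M]
  {Θ : EndoField n M} {e : OpenPartialHomeomorph M (EuclideanSpace ℝ (Fin n))} {y : M}

/-- The flat connection of a chart. -/
def chartCov (e : OpenPartialHomeomorph M (EuclideanSpace ℝ (Fin n))) (v : VecField n M)
    (y : M) : TangentSpace (𝓡 n) y →L[ℝ] TangentSpace (𝓡 n) y :=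
  chartDerivInv e y ∘L fderiv ℝ (chartPush e v) (e y) ∘L chartDeriv e y

variable [IsManifold (𝓡 n) ∞ M] (he : e ∈ IsManifold.maximalAtlas (𝓡 n) ∞ M)
include he

/-- The axioms of a covariant derivative and its torsion concern fields differentiable at one point
only, so the smooth version does not suffice. -/
lemma differentiableAt_chartPush {v : VecField n M} (hy : y ∈ e.source)
    (hv : MDifferentiableAt (𝓡 n) ((𝓡 n).prod 𝓘(ℝ, EuclideanSpace ℝ (Fin n)))
      (fun x => (⟨x, v x⟩ : Bundle.TotalSpace (EuclideanSpace ℝ (Fin n))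
        (TangentSpace (𝓡 n) : M → Type _))) y) :
    DifferentiableAt ℝ (chartPush e v) (e y) := by
  have hz := e.map_source hy
  have h := MDifferentiableAt.mpullback_vectorField (V := v) (f := e.symm) (x₀ := e y) (n := ∞)
    (by rw [e.left_inv hy]; exact hv) (contMDiffAt_symm_of_mem_maximalAtlas he hz)
    (isInvertible_mfderiv_symm he hz) (WithTop.coe_le_coe.2 le_top)
  have h1 : DifferentiableAt ℝ (VectorField.mpullback (𝓡 n) (𝓡 n) e.symm v) (e y) :=
    MDifferentiableAt.differentiableAt
      (((contMDiff_snd_tangentBundle_modelSpace (EuclideanSpace ℝ (Fin n)) (𝓡 n)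
        (n := 1)).contMDiffAt.mdifferentiableAt one_ne_zero).comp _ h)
  refine h1.congr_of_eventuallyEq ?_
  filter_upwards [e.open_target.mem_nhds hz] with z hz using chartPush_eq_mpullback he v hz

lemma isCovariantDerivativeOn_chartCov :
    IsCovariantDerivativeOn (I := 𝓡 n) (EuclideanSpace ℝ (Fin n))
      (V := (TangentSpace (𝓡 n) : M → Type _)) (chartCov e) e.source where
  add {σ σ' x} hσ hσ' hx := by
    have h1 : chartPush e (σ + σ') = chartPush e σ + chartPush e σ' := by
      funext z
      exact map_add (chartDeriv e (e.symm z)) _ _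
    rw [chartCov, h1, fderiv_add (differentiableAt_chartPush he hx hσ)
      (differentiableAt_chartPush he hx hσ')]
    ext1 u
    simp [chartCov]
  leibniz {σ g x} hσ hg hx := by
    have h1 : chartPush e (g • σ) = fun z => (g ∘ e.symm) z • chartPush e σ z := by
      funext z
      exact map_smul (chartDeriv e (e.symm z)) _ _
    have hz := e.map_source hx
    have hs := ((mdifferentiable_of_mem_maximalAtlas he).mdifferentiableAt_symm hz)
    have hg' : MDifferentiableAt (𝓡 n) 𝓘(ℝ, ℝ) g (e.symm (e x)) := by
      rw [e.left_inv hx]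
      exact hg
    have hd : DifferentiableAt ℝ (g ∘ e.symm) (e x) := (hg'.comp _ hs).differentiableAt
    have h2 : ∀ u, fderiv ℝ (g ∘ e.symm) (e x) (chartDeriv e x u) = mvfderiv (𝓡 n) g x u := by
      intro u
      have h3 : (g ∘ e.symm) ∘ e =ᶠ[𝓝 x] g := by
        filter_upwards [e.open_source.mem_nhds hx] with z hz
        simp [e.left_inv hz]
      have h4 := mfderiv_comp x (hg'.comp _ hs)
        ((mdifferentiable_of_mem_maximalAtlas he).mdifferentiableAt hx)
      rw [h3.mfderiv_eq, mfderiv_eq_fderiv] at h4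
      exact (congrArg (fun T => T u) h4).symm
    rw [chartCov, h1]
    ext1 u
    simp only [ContinuousLinearMap.comp_apply]
    rw [fderiv_fun_smul hd (differentiableAt_chartPush he hx hσ)]
    simp only [add_apply, smul_apply, ContinuousLinearMap.smulRight_apply, map_add, map_smul, h2,
      Function.comp_apply, e.left_inv hx, chartPush_apply hx, chartDerivInv_chartDeriv he hx]
    rfl

lemma chartCov_sub_chartCov {v w : VecField n M} (hy : y ∈ e.source)
    (hv : MDifferentiableAt (𝓡 n) ((𝓡 n).prod 𝓘(ℝ, EuclideanSpace ℝ (Fin n)))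
      (fun x => (⟨x, v x⟩ : Bundle.TotalSpace (EuclideanSpace ℝ (Fin n))
        (TangentSpace (𝓡 n) : M → Type _))) y)
    (hw : MDifferentiableAt (𝓡 n) ((𝓡 n).prod 𝓘(ℝ, EuclideanSpace ℝ (Fin n)))
      (fun x => (⟨x, w x⟩ : Bundle.TotalSpace (EuclideanSpace ℝ (Fin n))
        (TangentSpace (𝓡 n) : M → Type _))) y) :
    chartCov e w y (v y) - chartCov e v y (w y) = VectorField.mlieBracket (𝓡 n) v w y := by
  apply chartDeriv_injective he hy
  rw [chartPush_mlieBracket he hy hv hw, map_sub, chartPush_apply hy, chartPush_apply hy]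
  simp [chartCov, chartDeriv_chartDerivInv he hy]

/-- In a chart where Θ is a constant `A`, Θ is parallel because `A` commutes with differentiation of
coordinate expressions. -/
lemma chartCov_app {A : EuclideanSpace ℝ (Fin n) →L[ℝ] EuclideanSpace ℝ (Fin n)}
    (hA : ∀ y ∈ e.source, ∀ v, chartDeriv e y (Θ y v) = A (chartDeriv e y v)) {v : VecField n M}
    (hv : v.IsSmooth) (hy : y ∈ e.source) (u : TangentSpace (𝓡 n) y) :
    chartCov e (Θ.app v) y u = Θ y (chartCov e v y u) := by
  apply chartDeriv_injective he hy
  have h1 : chartPush e (Θ.app v) =ᶠ[𝓝 (e y)] fun z => A (chartPush e v z) := by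
    filter_upwards [e.open_target.mem_nhds (e.map_source hy)] with z hz
    exact hA _ (e.map_target hz) _
  have h2 : HasFDerivAt (fun z => A (chartPush e v z))
      (A ∘L fderiv ℝ (chartPush e v) (e y)) (e y) :=
    A.hasFDerivAt.comp _ (differentiableAt_chartPush he hy (hv.mdifferentiableAt y)).hasFDerivAt
  rw [hA y hy, chartCov, chartCov, h1.fderiv_eq, h2.fderiv]
  simp [chartDeriv_chartDerivInv he hy]

omit he

/-- A field of endomorphisms is smooth if it maps smooth fields to smooth fields. -/
lemma contMDiffAt_endo_of_forall {s : EndoField n M}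
    (h : ∀ X : VecField n M, ContMDiffAt (𝓡 n) ((𝓡 n).prod 𝓘(ℝ, EuclideanSpace ℝ (Fin n))) ∞
      (fun x => (⟨x, X x⟩ : Bundle.TotalSpace (EuclideanSpace ℝ (Fin n))
        (TangentSpace (𝓡 n) : M → Type _))) y →
      ContMDiffAt (𝓡 n) ((𝓡 n).prod 𝓘(ℝ, EuclideanSpace ℝ (Fin n))) ∞
      (fun x => (⟨x, s x (X x)⟩ : Bundle.TotalSpace (EuclideanSpace ℝ (Fin n))
        (TangentSpace (𝓡 n) : M → Type _))) y) :
    ContMDiffAt (𝓡 n)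
      ((𝓡 n).prod 𝓘(ℝ, EuclideanSpace ℝ (Fin n) →L[ℝ] EuclideanSpace ℝ (Fin n))) ∞
      (fun x => (⟨x, s x⟩ :
        Bundle.TotalSpace (EuclideanSpace ℝ (Fin n) →L[ℝ] EuclideanSpace ℝ (Fin n))
          (fun x : M => TangentSpace (𝓡 n) x →L[ℝ] TangentSpace (𝓡 n) x))) y := by
  rw [contMDiffAt_hom_bundle]
  refine ⟨contMDiffAt_id, ?_⟩
  let b : Module.Basis (Fin n) ℝ (EuclideanSpace ℝ (Fin n)) :=
    (EuclideanSpace.basisFun (Fin n) ℝ).toBasis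
  let t := trivializationAt (EuclideanSpace ℝ (Fin n)) (TangentSpace (𝓡 n) : M → Type _) y
  have hty : y ∈ t.baseSet := mem_baseSet_trivializationAt _ _ y
  -- The columns of the matrix of `s` in the trivialization are its values on the local frame;
  -- below, the matrix is reassembled from them.
  have h1 : ∀ i, ContMDiffAt (𝓡 n) 𝓘(ℝ, EuclideanSpace ℝ (Fin n)) ∞
      (fun x => (t ⟨x, s x (t.localFrame b i x)⟩).2) y := fun i =>
    (Bundle.contMDiffAt_section y).1
      (h _ ((t.contMDiffOn_localFrame_baseSet ∞ b i).contMDiffAt (t.open_baseSet.mem_nhds hty)))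
  have h2 : ContMDiffAt (𝓡 n) 𝓘(ℝ, EuclideanSpace ℝ (Fin n) →L[ℝ] EuclideanSpace ℝ (Fin n)) ∞
      (fun x => ∑ i, (ContinuousLinearMap.smulRightL ℝ (EuclideanSpace ℝ (Fin n))
        (EuclideanSpace ℝ (Fin n)) (LinearMap.toContinuousLinearMap (b.coord i)))
          (t ⟨x, s x (t.localFrame b i x)⟩).2) y := by
    refine ContMDiffAt.sum fun i _ => ?_
    exact (ContinuousLinearMap.contMDiff _).contMDiffAt.comp y (h1 i)
  refine h2.congr_of_eventuallyEq ?_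
  filter_upwards [t.open_baseSet.mem_nhds hty] with x hx
  refine ContinuousLinearMap.coe_injective (b.ext fun i => ?_)
  have hL : ContinuousLinearMap.inCoordinates (EuclideanSpace ℝ (Fin n))
      (TangentSpace (𝓡 n) : M → Type _) (EuclideanSpace ℝ (Fin n))
      (TangentSpace (𝓡 n) : M → Type _) y x y x (s x) (b i) =
        (t ⟨x, s x (t.localFrame b i x)⟩).2 := by
    rw [ContinuousLinearMap.inCoordinates_eq hx hx, t.localFrame_apply_of_mem_baseSet b hx]
    simp [Bundle.Trivialization.basisAt, t]
  refine hL.trans ?_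
  rw [ContinuousLinearMap.coe_coe, sum_apply, Finset.sum_eq_single i]
  · simp
  · intro j _ hj
    simp [Ne.symm hj]
  · simp

include he

lemma contMDiffAt_chartCov {v : VecField n M} (hy : y ∈ e.source) (hv : v.IsSmooth) :
    ContMDiffAt (𝓡 n)
      ((𝓡 n).prod 𝓘(ℝ, EuclideanSpace ℝ (Fin n) →L[ℝ] EuclideanSpace ℝ (Fin n))) ∞
      (fun x => (⟨x, chartCov e v x⟩ :
        Bundle.TotalSpace (EuclideanSpace ℝ (Fin n) →L[ℝ] EuclideanSpace ℝ (Fin n))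
          (fun x : M => TangentSpace (𝓡 n) x →L[ℝ] TangentSpace (𝓡 n) x))) y := by
  refine contMDiffAt_endo_of_forall fun X hX => ?_
  have h1 : ContDiffAt ℝ ∞ (fun z => fderiv ℝ (chartPush e v) z (chartPush e X z)) (e y) :=
    ((contDiffAt_chartPush he hy (hv y)).fderiv_right (by simp)).clm_apply
      (contDiffAt_chartPush he hy hX)
  refine (contMDiffAt_chartPull he hy h1).congr_of_eventuallyEq ?_
  filter_upwards [e.open_source.mem_nhds hy] with x hx
  simp only [chartPull, chartPush_apply hx]
  rfl

end ChartConnection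

/-! ### Averaging chart connections by a partition of unity. -/

section Gluing

variable {n : ℕ} {M : Type*} [TopologicalSpace M] [ChartedSpace (EuclideanSpace ℝ (Fin n)) M]

/-- Turns each pointwise identity for the averaged connection into a finite sum over charts that
contain the point. -/
lemma exists_finset_finsum_smul_eq {ι : Type*}
    (ρ : SmoothPartitionOfUnity ι (𝓡 n) M Set.univ) {U : ι → Set M} (hρ : ρ.IsSubordinate U)
    (x : M) : ∃ S : Finset ι, (∀ i ∈ S, x ∈ U i) ∧ ∑ i ∈ S, ρ i x = 1 ∧
      ∀ f : ι → TangentSpace (𝓡 n) x →L[ℝ] TangentSpace (𝓡 n) x,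
        ∑ᶠ i, ρ i x • f i = ∑ i ∈ S, ρ i x • f i := by
  refine ⟨ρ.finsupport x, fun i hi => ?_, ρ.sum_finsupport x (Set.mem_univ x), fun f => ?_⟩
  · rw [ρ.mem_finsupport] at hi
    exact hρ i (subset_tsupport _ hi)
  · refine finsum_eq_sum_of_support_subset _ fun i hi => ?_
    rw [SmoothPartitionOfUnity.coe_finsupport]
    intro h0
    have h0' : ρ i x = 0 := h0
    exact hi (by simp only; rw [h0', zero_smul])

variable [IsManifold (𝓡 n) ∞ M] {Θ : EndoField n M}

/-- A convex combination of torsion-free connections for which Θ is parallel is again one; charts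
adapted to Θ provide such connections locally. -/
theorem EndoField.LocallyConstant.integrable [T2Space M] [SecondCountableTopology M]
    (h : Θ.LocallyConstant) : Θ.Integrable := by
  choose e he hx A hA using h
  have : LocallyCompactSpace M :=
    ChartedSpace.locallyCompactSpace (EuclideanSpace ℝ (Fin n)) M
  obtain ⟨ρ, hρ⟩ := SmoothPartitionOfUnity.exists_isSubordinate (I := 𝓡 n) (s := Set.univ)
    isClosed_univ (fun x => (e x).source) (fun x => (e x).open_source)
    (fun x _ => Set.mem_iUnion.2 ⟨x, hx x⟩)
  have hfin := exists_finset_finsum_smul_eq ρ hρ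
  have hcov : IsCovariantDerivativeOn (I := 𝓡 n) (EuclideanSpace ℝ (Fin n))
      (V := (TangentSpace (𝓡 n) : M → Type _))
      (fun v x => ∑ᶠ i, ρ i x • chartCov (e i) v x) Set.univ := by
    constructor
    · intro σ σ' x hσ hσ' _
      obtain ⟨S, hS, -, hsum⟩ := hfin x
      simp only [hsum]
      rw [← Finset.sum_add_distrib]
      refine Finset.sum_congr rfl fun i hi => ?_
      rw [(isCovariantDerivativeOn_chartCov (he i)).add hσ hσ' (hS i hi), smul_add]
    · intro σ g x hσ hg _
      obtain ⟨S, hS, hS1, hsum⟩ := hfin x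
      simp only [hsum]
      -- The inhomogeneous Leibniz term survives averaging because the weights sum to 1; the same
      -- holds for the bracket in the torsion identity.
      rw [Finset.smul_sum, ← one_smul ℝ ((mvfderiv (𝓡 n) g x).smulRight (σ x)), ← hS1,
        Finset.sum_smul, ← Finset.sum_add_distrib]
      refine Finset.sum_congr rfl fun i hi => ?_
      rw [(isCovariantDerivativeOn_chartCov (he i)).leibniz hσ hg (hS i hi), smul_add, smul_comm]
  refine ⟨⟨_, hcov⟩, ⟨⟨fun {v} hv => ?_⟩⟩, ?_, fun v hv x u => ?_⟩
  · have hv' : VecField.IsSmooth v := contMDiffOn_univ.1 hv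
    rw [contMDiffOn_univ]
    refine ContMDiff.finsum_section_of_locallyFinite (t := fun i x => ρ i x • chartCov (e i) v x)
      (ρ.locallyFinite.subset fun i x hx h0 => hx ?_) fun i => ?_
    · have h0' : ρ i x = 0 := h0
      rw [h0', zero_smul]
    · exact ContMDiffOn.smul_section_of_tsupport (u := (e i).source)
        (s := fun x => chartCov (e i) v x)
        (ρ i).contMDiff.contMDiffOn (e i).open_source (hρ i)
        fun x hx => (contMDiffAt_chartCov (he i) hx hv').contMDiffWithinAt
  · rw [CovariantDerivative.torsion_eq_zero_iff]
    intro X Y x hX hY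
    obtain ⟨S, hS, hS1, hsum⟩ := hfin x
    simp only [hsum, sum_apply, smul_apply]
    rw [← Finset.sum_sub_distrib, ← one_smul ℝ (VectorField.mlieBracket (𝓡 n) X Y x), ← hS1,
      Finset.sum_smul]
    refine Finset.sum_congr rfl fun i hi => ?_
    rw [← smul_sub, chartCov_sub_chartCov (he i) (hS i hi) hX hY]
  · obtain ⟨S, hS, hS1, hsum⟩ := hfin x
    simp only [hsum, sum_apply, smul_apply, map_sum, map_smul]
    rw [sub_eq_zero]
    refine Finset.sum_congr rfl fun i hi => ?_
    rw [chartCov_app (he i) (hA i) hv (hS i hi)]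

end Gluing

end NilpotentTensor

end


theorem theoremA {n : ℕ} (hn : 1 ≤ n) {M : Type*} [TopologicalSpace M] [T2Space M]
    [SecondCountableTopology M] [ConnectedSpace M]
    [ChartedSpace (EuclideanSpace ℝ (Fin n)) M] [IsManifold (𝓡 n) ∞ M]
    (Θ : NilpotentTensor.EndoField n M) (hsmooth : Θ.IsSmooth)
    (hconst : Θ.AlgebraicallyConstant) (hnil : Θ.Nilpotent) :
    List.TFAE [
      Θ.NijenhuisVanishes ∧
        ∀ i ∈ Finset.Icc 1 n, NilpotentTensor.IsIntegrableDistribution (Θ.kerPow i),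
      Θ.HasCommutingJordanFrames,
      Θ.LocallyConstant,
      Θ.Integrable] := by
  tfae_have 3 → 1 := fun h =>
    ⟨h.nijenhuisVanishes hsmooth, fun i _ => h.isIntegrableDistribution_kerPow i⟩
  tfae_have 1 → 3 := fun h =>
    NilpotentTensor.locallyConstant_of_involutive hsmooth hconst hnil h.1
      (NilpotentTensor.kerInvolutive_of_isIntegrableDistribution hn h.2)
  tfae_have 3 → 2 := fun h => h.hasCommutingJordanFrames hnil
  tfae_have 2 → 3 := fun h => h.locallyConstant
  tfae_have 3 → 4 := fun h => h.integrable
  tfae_have 4 → 3 := fun h =>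
    NilpotentTensor.locallyConstant_of_involutive hsmooth hconst hnil (h.nijenhuisVanishes hsmooth)
      (h.kerInvolutive hsmooth)
  tfae_finish
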